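/- Let $\lambda\in\mathbb{Q}^{\times}$ with $\lambda\neq\pm 1$, and let $m>1$ be an integer. Let $C$ be the smooth projective hyperelliptic curve over $\mathbb{Q}$ (of genus $m-1$) defined by the affine equation $$y^2=x^{2m}-(1+\lambda^2)x^m+\lambda^2 .$$ Then $C$ has a rational Weierstrass point, that is, a $\mathbb{Q}$-rational point fixed by the hyperelliptic involution $(x,y)\mapsto(x,-y)$. Moreover, the torsion subgroup of the group of rational points of its Jacobian satisfies $$\operatorname{rank}_m \operatorname{Jac}(C)(\mathbb{Q})_{\mathrm{tors}}\geq 2,$$ where, for an integer $m>1$ and a finite abelian group $M$, $\operatorname{rank}_m M$ denotes the largest integer $r$ such that $M$ has a subgroup isomorphic to $(\mathbb{Z}/m\mathbb{Z})^r$. -/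

import Mathlib

noncomputable section

/-! ### Points, divisors and Picard group of a smooth projective curve over an algebraically
closed field, read off from its function field -/

/-- Let `F` be a function field of one variable over an algebraically closed field `K`. The closed
points of the smooth projective curve over `K` with function field `F` are the normalized discrete
valuations of `F` that are trivial on `K`: the point `P` corresponds to the order of vanishing
`ord_P : F → ℤ ∪ {∞}`. -/
structure CurvePoint (K F : Type*) [Field K] [Field F] [Algebra K F] where
  /-- The order of vanishing at the point. -/
  ord : AddValuation F (WithTop ℤ)
  ord_const : ∀ c : K, c ≠ 0 → ord (algebraMap K F c) = 0
  ord_surjective : Function.Surjective ord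

/-- Divisors: finite formal `ℤ`-linear combinations of points. -/
abbrev CurveDivisor (K F : Type*) [Field K] [Field F] [Algebra K F] : Type _ :=
  CurvePoint K F →₀ ℤ

namespace CurveDivisor

variable (K F : Type*) [Field K] [Field F] [Algebra K F]

/-- The degree of a divisor, the sum of its coefficients. (All closed points have degree one when
`K` is algebraically closed, the only case that is used.) -/
def deg : CurveDivisor K F →+ ℤ :=
  Finsupp.liftAddHom fun _ => AddMonoidHom.id ℤ

/-- The group of divisors of degree zero. -/
def degZero : AddSubgroup (CurveDivisor K F) := (deg K F).ker

/-- The group of principal divisors `div g = ∑ ord_P(g) P`, for `g` a nonzero function. -/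
def principal : AddSubgroup (CurveDivisor K F) where
  carrier := {D | ∃ g : F, g ≠ 0 ∧ ∀ P : CurvePoint K F, P.ord g = (D P : WithTop ℤ)}
  zero_mem' := ⟨1, one_ne_zero, fun P => by simp⟩
  add_mem' := by
    rintro D E ⟨g, hg, hD⟩ ⟨h, hh, hE⟩
    exact ⟨g * h, mul_ne_zero hg hh, fun P => by simp [AddValuation.map_mul, hD, hE]⟩
  neg_mem' := by
    rintro D ⟨g, hg, hD⟩
    refine ⟨g⁻¹, inv_ne_zero hg, fun P => ?_⟩
    rw [AddValuation.map_inv, hD]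
    rfl

end CurveDivisor

/-- `Pic⁰`: divisors of degree zero modulo principal divisors. -/
abbrev CurvePicZero (K F : Type*) [Field K] [Field F] [Algebra K F] : Type _ :=
  CurveDivisor.degZero K F ⧸
    (CurveDivisor.principal K F).addSubgroupOf (CurveDivisor.degZero K F)

/-! ### Action of semilinear automorphisms of the function field -/

/-- A ring automorphism of `F` together with the automorphism of `K` that it induces. -/
structure SemilinearAut (K F : Type*) [Field K] [Field F] [Algebra K F] where
  base : K ≃+* K
  toRingEquiv : F ≃+* F
  map_const : ∀ c : K, toRingEquiv (algebraMap K F c) = algebraMap K F (base c)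

namespace SemilinearAut

variable {K F : Type*} [Field K] [Field F] [Algebra K F]

/-- The inverse automorphism. -/
def symm (τ : SemilinearAut K F) : SemilinearAut K F where
  base := τ.base.symm
  toRingEquiv := τ.toRingEquiv.symm
  map_const c := by
    rw [RingEquiv.symm_apply_eq, τ.map_const, RingEquiv.apply_symm_apply]

/-- The image of a point: `ord_{τ P}(g) = ord_P(τ⁻¹ g)`. -/
def pointMap (τ : SemilinearAut K F) (P : CurvePoint K F) : CurvePoint K F where
  ord := P.ord.comap τ.symm.toRingEquiv.toRingHom
  ord_const c hc := by
    change P.ord (τ.symm.toRingEquiv (algebraMap K F c)) = 0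
    rw [τ.symm.map_const]
    exact P.ord_const _ (by simpa using hc)
  ord_surjective := P.ord_surjective.comp τ.symm.toRingEquiv.surjective

theorem ord_pointMap (τ : SemilinearAut K F) (P : CurvePoint K F) (g : F) :
    (τ.pointMap P).ord g = P.ord (τ.toRingEquiv.symm g) := rfl

/-- The bijection that an automorphism induces on points. -/
def pointEquiv (τ : SemilinearAut K F) : CurvePoint K F ≃ CurvePoint K F where
  toFun := τ.pointMap
  invFun := τ.symm.pointMap
  left_inv P := by
    obtain ⟨P_ord, _, _⟩ := P
    simp only [pointMap, CurvePoint.mk.injEq]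
    refine AddValuation.ext fun g => ?_
    exact congrArg P_ord (τ.toRingEquiv.symm_apply_apply g)
  right_inv P := by
    obtain ⟨P_ord, _, _⟩ := P
    simp only [pointMap, CurvePoint.mk.injEq]
    refine AddValuation.ext fun g => ?_
    exact congrArg P_ord (τ.toRingEquiv.apply_symm_apply g)

/-- The action on divisors, `∑ n_P P ↦ ∑ n_P τ(P)`. -/
def divisorMap (τ : SemilinearAut K F) : CurveDivisor K F →+ CurveDivisor K F :=
  (Finsupp.domCongr τ.pointEquiv).toAddMonoidHom

theorem deg_divisorMap (τ : SemilinearAut K F) (D : CurveDivisor K F) :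
    CurveDivisor.deg K F (τ.divisorMap D) = CurveDivisor.deg K F D := by
  simp only [divisorMap, CurveDivisor.deg]
  exact Finsupp.sum_equivMapDomain _ _ _

theorem divisorMap_mem_principal (τ : SemilinearAut K F) {D : CurveDivisor K F}
    (hD : D ∈ CurveDivisor.principal K F) : τ.divisorMap D ∈ CurveDivisor.principal K F := by
  obtain ⟨g, hg, h⟩ := hD
  refine ⟨τ.toRingEquiv g, by simpa using hg, fun P => ?_⟩
  have := h (τ.symm.pointMap P)
  rw [ord_pointMap] at this
  exact this

/-- The action on divisors of degree zero. -/
def degZeroMap (τ : SemilinearAut K F) :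
    CurveDivisor.degZero K F →+ CurveDivisor.degZero K F :=
  (τ.divisorMap.comp (CurveDivisor.degZero K F).subtype).codRestrict (CurveDivisor.degZero K F)
    fun D => (τ.deg_divisorMap D.1).trans D.2

/-- The action on `Pic⁰`, `[D] ↦ [τ(D)]`. -/
def picMap (τ : SemilinearAut K F) : CurvePicZero K F →+ CurvePicZero K F :=
  QuotientAddGroup.map _ _ τ.degZeroMap fun _ hD => τ.divisorMap_mem_principal hD

end SemilinearAut

/-! ### Hyperelliptic curves -/

open Polynomial in
/-- The smooth projective hyperelliptic curve with affine equation `y² = f(x)` over a field `k` of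
characteristic zero, where `f` is a separable polynomial of degree at least three (so that the curve
is geometrically irreducible, of genus at least one). -/
structure HyperellipticCurve (k : Type*) [Field k] [CharZero k] where
  f : k[X]
  separable : f.Separable
  three_le_natDegree : 3 ≤ f.natDegree

namespace HyperellipticCurve

open Polynomial

/-- The automorphism of `k̄(x)` that `σ ∈ Gal(k̄/k)` induces on coefficients. -/
def ratFuncAut {k : Type*} [Field k] (σ : AlgebraicClosure k ≃ₐ[k] AlgebraicClosure k) :
    RatFunc (AlgebraicClosure k) ≃+* RatFunc (AlgebraicClosure k) :=
  IsFractionRing.ringEquivOfRingEquiv (Polynomial.mapEquiv σ.toRingEquiv)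

theorem ratFuncAut_algebraMap {k : Type*} [Field k]
    (σ : AlgebraicClosure k ≃ₐ[k] AlgebraicClosure k) (p : (AlgebraicClosure k)[X]) :
    ratFuncAut σ (algebraMap _ _ p) = algebraMap _ _ (p.map (σ : _ →+* AlgebraicClosure k)) :=
  IsFractionRing.ringEquivOfRingEquiv_algebraMap _ _

variable {k : Type*} [Field k] [CharZero k] (C : HyperellipticCurve k)

/-- The polynomial `f`, as a rational function of `x` with coefficients in the algebraic closure. -/
def rhs : RatFunc (AlgebraicClosure k) :=
  algebraMap (AlgebraicClosure k)[X] (RatFunc (AlgebraicClosure k))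
    (C.f.map (algebraMap k (AlgebraicClosure k)))

theorem irreducible_equation : Irreducible (X ^ 2 - Polynomial.C C.rhs) := by
  refine X_pow_sub_C_irreducible_of_prime Nat.prime_two fun b hb => ?_
  have hint : IsIntegral (AlgebraicClosure k)[X] b := by
    refine IsIntegral.of_pow (n := 2) two_pos ?_
    rw [hb]
    exact isIntegral_algebraMap
  obtain ⟨p, rfl⟩ := IsIntegrallyClosed.isIntegral_iff.mp hint
  have hp : p ^ 2 = C.f.map (algebraMap k (AlgebraicClosure k)) := by
    apply RatFunc.algebraMap_injective (AlgebraicClosure k)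
    rw [map_pow, hb, rhs]
  have hsq : Squarefree (p ^ 2) := hp ▸ (C.separable.map).squarefree
  have hu : IsUnit p := hsq p (by rw [sq])
  have h1 := natDegree_eq_zero_of_isUnit (hu.pow 2)
  rw [hp, natDegree_map] at h1
  have := C.three_le_natDegree
  omega

instance : Fact (Irreducible (X ^ 2 - Polynomial.C C.rhs)) := ⟨C.irreducible_equation⟩

/-- The function field `k̄(C) = k̄(x)[y] / (y² - f(x))` of the curve over the algebraic closure
`k̄` of `k`. -/
abbrev FunctionField : Type _ := AdjoinRoot (X ^ 2 - Polynomial.C C.rhs)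

/-- The geometric points `C(k̄)`. -/
abbrev GeomPoint : Type _ := CurvePoint (AlgebraicClosure k) C.FunctionField

theorem ratFuncAut_rhs (σ : AlgebraicClosure k ≃ₐ[k] AlgebraicClosure k) :
    ratFuncAut σ C.rhs = C.rhs := by
  rw [rhs, ratFuncAut_algebraMap, Polynomial.map_map]
  congr 2
  exact RingHom.ext fun c => σ.commutes c

/-- The automorphism of `k̄(C)` that acts as `σ ∈ Gal(k̄/k)` on constants and fixes `x` and `y`. -/
def galAut (σ : AlgebraicClosure k ≃ₐ[k] AlgebraicClosure k) :
    SemilinearAut (AlgebraicClosure k) C.FunctionField where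
  base := σ.toRingEquiv
  toRingEquiv := AdjoinRoot.mapRingEquiv (ratFuncAut σ) _ _ <| by
    simp [C.ratFuncAut_rhs]
  map_const c := by
    have h (a : AlgebraicClosure k) : algebraMap (AlgebraicClosure k) C.FunctionField a =
        AdjoinRoot.of _ (algebraMap _ (RatFunc (AlgebraicClosure k)) (Polynomial.C a)) := rfl
    rw [h, h, AdjoinRoot.coe_mapRingEquiv, AdjoinRoot.map_of]
    simp only [RingHom.coe_coe]
    rw [ratFuncAut_algebraMap, Polynomial.map_C]
    rfl

theorem eval₂_neg_root : eval₂ (AdjoinRoot.of (X ^ 2 - Polynomial.C C.rhs))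
    (-AdjoinRoot.root (X ^ 2 - Polynomial.C C.rhs)) (X ^ 2 - Polynomial.C C.rhs) = 0 := by
  have h := AdjoinRoot.eval₂_root (X ^ 2 - Polynomial.C C.rhs)
  rw [eval₂_sub, eval₂_X_pow, eval₂_C] at h ⊢
  rwa [neg_sq]

/-- The hyperelliptic involution `(x, y) ↦ (x, -y)`, as an automorphism of the function field. -/
def involution : SemilinearAut (AlgebraicClosure k) C.FunctionField where
  base := RingEquiv.refl _
  toRingEquiv :=
    RingEquiv.ofRingHom
      (AdjoinRoot.lift (AdjoinRoot.of _) (-AdjoinRoot.root _) C.eval₂_neg_root)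
      (AdjoinRoot.lift (AdjoinRoot.of _) (-AdjoinRoot.root _) C.eval₂_neg_root)
      (by ext <;> simp) (by ext <;> simp)
  map_const _ := AdjoinRoot.lift_of C.eval₂_neg_root

/-- A geometric point is `k`-rational when it is fixed by `Gal(k̄/k)`. -/
def IsRationalPoint (P : C.GeomPoint) : Prop :=
  ∀ σ : AlgebraicClosure k ≃ₐ[k] AlgebraicClosure k, (C.galAut σ).pointMap P = P

/-- The Weierstrass points of a hyperelliptic curve: the ramification points of the double cover
`x : C → ℙ¹`, that is, the fixed points of the hyperelliptic involution. -/
def IsWeierstrassPoint (P : C.GeomPoint) : Prop :=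
  C.involution.pointMap P = P

/-- The geometric points `Jac(C)(k̄) = Pic⁰(C_k̄)` of the Jacobian. -/
abbrev JacGeom : Type _ := CurvePicZero (AlgebraicClosure k) C.FunctionField

/-- The group `Jac(C)(k) = Pic⁰(C_k̄)^{Gal(k̄/k)}` of `k`-rational points of the Jacobian. -/
def jacRational : AddSubgroup C.JacGeom where
  carrier := {c | ∀ σ : AlgebraicClosure k ≃ₐ[k] AlgebraicClosure k, (C.galAut σ).picMap c = c}
  zero_mem' σ := map_zero _
  add_mem' ha hb σ := by rw [map_add, ha σ, hb σ]
  neg_mem' ha σ := by rw [map_neg, ha σ]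

end HyperellipticCurve

/-- The `m`-rank of an abelian group: the largest `r` such that `(ℤ/mℤ)^r` is isomorphic to a
subgroup (`⊤` if there is no largest one, which does not happen for finite groups and `m > 1`). -/
def mRank (m : ℕ) (A : Type*) [AddCommGroup A] : ℕ∞ :=
  ⨆ (r : ℕ) (_ : ∃ φ : (Fin r → ZMod m) →+ A, Function.Injective φ), (r : ℕ∞)

/-! ### The family of curves -/

open Polynomial in
/-- The smooth projective curve over `ℚ` with affine equation `y² = x^{2m} - (1 + λ²) x^m + λ²`. -/
def yamamotoCurve (l : ℚ) (hl : l ≠ 0) (hl1 : l ^ 2 ≠ 1) (m : ℕ) (hm : 1 < m) :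
    HyperellipticCurve ℚ where
  f := X ^ (2 * m) - C (1 + l ^ 2) * X ^ m + C (l ^ 2)
  separable := by
    have hm0 : (m : ℚ) ≠ 0 := by exact_mod_cast (by omega : m ≠ 0)
    have h : (X ^ (2 * m) - C (1 + l ^ 2) * X ^ m + C (l ^ 2) : ℚ[X]) =
        (X ^ m - C 1) * (X ^ m - C (l ^ 2)) := by
      simp only [map_add, map_one]
      ring
    rw [h]
    refine (separable_X_pow_sub_C 1 hm0 one_ne_zero).mul
      (separable_X_pow_sub_C _ hm0 (pow_ne_zero 2 hl)) ?_
    have hd : l ^ 2 - 1 ≠ 0 := sub_ne_zero.mpr hl1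
    refine ⟨C (l ^ 2 - 1)⁻¹, -C (l ^ 2 - 1)⁻¹, ?_⟩
    have : C (l ^ 2 - 1)⁻¹ * (C (l ^ 2) - C 1) = (1 : ℚ[X]) := by
      rw [← C_sub, ← C_mul, inv_mul_cancel₀ hd, C_1]
    linear_combination this
  three_le_natDegree := by
    have : (X ^ (2 * m) - C (1 + l ^ 2) * X ^ m + C (l ^ 2) : ℚ[X]).natDegree = 2 * m := by
      compute_degree!
      · rw [if_neg (by omega), if_neg (by omega)]; norm_num
      all_goals omega
    omega

end

/-!
Write `F = K(x)[y]` for the function field over the algebraic closure `K` of `ℚ`, let `∞₊` and `∞₋`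
be the points at infinity at which `y / x ^ m` is `1` and `-1`, and let `Z = (0, λ)`. The polynomial
`f = x ^ (2m) - (1 + λ²) x ^ m + λ²` satisfies

* `f = (x ^ m - (1 + λ²) / 2)² - ((1 - λ²) / 2)²`, so `2y - 2x ^ m + 1 + λ²` has no affine zeros or
  poles, and its divisor is `m (∞₊ - ∞₋)` (`yamamotoCurve.ord_linFun_infinity`);
* `f = (x ^ m + λ)² - (1 + λ)² x ^ m`, so `y - x ^ m - λ` vanishes only over `x = 0`, and its divisor
  is `m (Z - ∞₋)` (`yamamotoCurve.ord_linFun_zero`).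

Hence the classes of `∞₊ - ∞₋` and `Z - ∞₋` are killed by `m`, and they are rational because the
three points are. They are independent modulo `m`: if `a (∞₊ - ∞₋) + b (Z - ∞₋)` with
`0 ≤ a, b < m` is principal, then, possibly after subtracting `m (∞₊ - ∞₋)`, it is the divisor of a
function whose poles lie at infinity and have order less than `m`. Such a function depends
only on `x` (`HyperellipticCurve.involution_eq_self_of_small_poles`), so its divisor is invariant under
the hyperelliptic involution, which exchanges `∞₊` and `∞₋` and moves `Z` to `(0, -λ)`; this forces
`a = b = 0`. The rational Weierstrass point is `(1, 0)`.

Points are valuations of `F`, so they have to be constructed and recognized. They are constructed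
by embedding `F` into the field of Laurent series `K((T))`: power series with nonzero constant term
have square roots, so `y` can be expanded in a suitable parameter (`CurvePoint.ofAlgHom` and
`HyperellipticCurve.exists_algHom`). They are recognized by the values of two generators of `F`,
given an explicit generator of the maximal ideal (`IsLocalParameter.point_eq`); this determines the
points at infinity and over `x = 0`, and shows that the points in question are Galois invariant.
-/

noncomputable section

/-! ### Points of a curve and local parameters -/

namespace CurvePoint

variable {K F : Type*} [Field K] [Field F] [Algebra K F]

theorem ext_ord {P Q : CurvePoint K F} (h : ∀ g, P.ord g = Q.ord g) : P = Q := by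
  obtain ⟨p, _, _⟩ := P
  obtain ⟨q, _, _⟩ := Q
  simp only [mk.injEq]
  exact AddValuation.ext h

theorem exists_ord_eq (P : CurvePoint K F) {g : F} (hg : g ≠ 0) : ∃ n : ℤ, P.ord g = n := by
  obtain ⟨n, hn⟩ := WithTop.ne_top_iff_exists.mp ((P.ord.ne_top_iff).mpr hg)
  exact ⟨n, hn.symm⟩

/-- The valuation ring of a point. -/
def integers (P : CurvePoint K F) : Subalgebra K F where
  carrier := {g | 0 ≤ P.ord g}
  mul_mem' ha hb := by
    simp only [Set.mem_ofPred_eq, AddValuation.map_mul] at *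
    exact add_nonneg ha hb
  add_mem' ha hb := P.ord.map_le_add ha hb
  algebraMap_mem' c := by
    by_cases hc : c = 0
    · simp [hc]
    · exact (P.ord_const c hc).ge

theorem ord_algebraMap_nonneg (P : CurvePoint K F) (c : K) : 0 ≤ P.ord (algebraMap K F c) :=
  P.integers.algebraMap_mem c

theorem ord_nonneg_of_mem_adjoin {P : CurvePoint K F} {ξ η : F} (hξ : 0 ≤ P.ord ξ)
    (hη : 0 ≤ P.ord η) {h : F} (hh : h ∈ Algebra.adjoin K {ξ, η}) : 0 ≤ P.ord h := by
  have : Algebra.adjoin K {ξ, η} ≤ P.integers := by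
    rw [Algebra.adjoin_le_iff]
    rintro z (rfl | rfl)
    exacts [hξ, hη]
  exact this hh

theorem ord_nonneg_of_sq {P : CurvePoint K F} {g : F} (h : 0 ≤ P.ord (g ^ 2)) : 0 ≤ P.ord g := by
  rw [AddValuation.map_pow, two_nsmul] at h
  by_contra hlt
  rw [not_le] at hlt
  exact absurd h (not_le.mpr ((add_le_of_nonpos_left hlt.le).trans_lt hlt))

theorem ord_eq_sub_of_mul {P : CurvePoint K F} {g h : F} {i j : ℤ} (hgh : P.ord (g * h) = i)
    (hh : P.ord h = j) : P.ord g = ((i - j : ℤ) : WithTop ℤ) := by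
  rw [AddValuation.map_mul, hh] at hgh
  have hg : g ≠ 0 := by rintro rfl; simp at hgh
  obtain ⟨n, hn⟩ := P.exists_ord_eq hg
  rw [hn] at hgh ⊢
  have : n + j = i := by exact_mod_cast hgh
  rw [← this, add_sub_cancel_right]

theorem ord_eq_neg_one_of_inv {P : CurvePoint K F} {g : F} (h : P.ord g⁻¹ = 1) :
    P.ord g = ((-1 : ℤ) : WithTop ℤ) := by
  have hg : g ≠ 0 := by rintro rfl; simp at h
  exact ord_eq_sub_of_mul (i := 0) (j := 1)
    (by rw [mul_inv_cancel₀ hg, AddValuation.map_one]; rfl) h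

theorem ord_eq_zero_of_mul {P : CurvePoint K F} {g h : F} (hg : 0 ≤ P.ord g) (hh : 0 ≤ P.ord h)
    (hgh : P.ord (g * h) = 0) : P.ord g = 0 := by
  rw [AddValuation.map_mul] at hgh
  exact le_antisymm (hgh ▸ le_add_of_nonneg_right hh) hg

/-- A function congruent to a nonzero constant at `P` has order zero there. -/
theorem ord_eq_zero_of_sub_pos {P : CurvePoint K F} {g : F} {c : K} (hc : c ≠ 0)
    (h : 0 < P.ord (g - algebraMap K F c)) : P.ord g = 0 := by
  have h1 : P.ord (algebraMap K F c) < P.ord (g - algebraMap K F c) := by rwa [P.ord_const c hc]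
  rw [P.ord.map_eq_of_lt_sub h1, P.ord_const c hc]

end CurvePoint

/-- Generators `ξ, η` of the function field `F`, together with a function `u` that generates the
maximal ideal of the local ring at `(ξ, η) = (a, b)`: the function `s`, which is to be invertible
there, carries both `ξ - a` and `η - b` into `u K[ξ, η]`. -/
structure IsLocalParameter {K F : Type*} [Field K] [Field F] [Algebra K F]
    (ξ η : F) (a b : K) (s u : F) : Prop where
  adjoin_eq_top : IntermediateField.adjoin K {ξ, η} = ⊤
  left : ∃ α ∈ Algebra.adjoin K {ξ, η}, s * (ξ - algebraMap K F a) = u * α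
  right : ∃ β ∈ Algebra.adjoin K {ξ, η}, s * (η - algebraMap K F b) = u * β

namespace IsLocalParameter

variable {K F : Type*} [Field K] [Field F] [Algebra K F] {ξ η : F} {a b : K} {s u : F}

/-- The value of a function of `K[ξ, η]` at `(a, b)`; the remainder is divisible by `u` after
multiplication by `s`. -/
theorem exists_residue (H : IsLocalParameter ξ η a b s u) {h : F}
    (hh : h ∈ Algebra.adjoin K {ξ, η}) :
    ∃ c : K, ∃ g ∈ Algebra.adjoin K {ξ, η}, s * (h - algebraMap K F c) = u * g := by
  induction hh using Algebra.adjoin_induction with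
  | mem z hz =>
    rcases hz with rfl | rfl
    · exact ⟨a, H.left⟩
    · exact ⟨b, H.right⟩
  | algebraMap c => exact ⟨c, 0, zero_mem _, by simp⟩
  | add z w _ _ hz hw =>
    obtain ⟨c, g, hg, e⟩ := hz
    obtain ⟨d, k, hk, e'⟩ := hw
    refine ⟨c + d, g + k, add_mem hg hk, ?_⟩
    rw [map_add]
    linear_combination e + e'
  | mul z w _ hw' hz hw =>
    obtain ⟨c, g, hg, e⟩ := hz
    obtain ⟨d, k, hk, e'⟩ := hw
    refine ⟨c * d, g * w + algebraMap K F c * k,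
      add_mem (mul_mem hg hw') (mul_mem (Subalgebra.algebraMap_mem _ _) hk), ?_⟩
    rw [map_mul]
    linear_combination w * e + algebraMap K F c * e'

variable {P Q : CurvePoint K F}

/-- Every nonzero element of `K[ξ, η]` is a power of `u` up to functions that are units at every
point lying over `(a, b)`. -/
theorem exists_pow_of_mem (H : IsLocalParameter ξ η a b s u)
    (hPs : P.ord s = 0) (hPu : 0 < P.ord u)
    (hQs : Q.ord s = 0) (hQu : 0 < Q.ord u)
    (hPR : ∀ h ∈ Algebra.adjoin K {ξ, η}, 0 ≤ P.ord h)
    (hQR : ∀ h ∈ Algebra.adjoin K {ξ, η}, 0 ≤ Q.ord h) (n : ℕ) :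
    ∀ h ∈ Algebra.adjoin K {ξ, η}, h ≠ 0 → P.ord h < ((n : ℤ) : WithTop ℤ) →
      ∃ k : ℕ, P.ord h = k • P.ord u ∧ Q.ord h = k • Q.ord u := by
  induction n with
  | zero =>
    intro h hh _ hlt
    exact absurd (hPR h hh) (not_le.mpr (by simpa using hlt))
  | succ n ih =>
    intro h hh h0 hlt
    obtain ⟨c, g, hg, e⟩ := H.exists_residue hh
    by_cases hc : c = 0
    · subst hc
      rw [map_zero, sub_zero] at e
      have hs0 : s ≠ 0 := by rintro rfl; simp at hPs
      have hug : u * g ≠ 0 := e ▸ mul_ne_zero hs0 h0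
      have hg0 := right_ne_zero_of_mul hug
      have eP := congrArg P.ord e
      have eQ := congrArg Q.ord e
      rw [AddValuation.map_mul, AddValuation.map_mul, hPs, zero_add] at eP
      rw [AddValuation.map_mul, AddValuation.map_mul, hQs, zero_add] at eQ
      obtain ⟨k, h1, h2⟩ := ih g hg hg0 <| by
        rw [eP] at hlt
        obtain ⟨i, hi⟩ := P.exists_ord_eq (left_ne_zero_of_mul hug)
        obtain ⟨j, hj⟩ := P.exists_ord_eq hg0
        rw [hi] at hPu hlt
        rw [hj] at hlt ⊢
        norm_cast at *
        push_cast at hlt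
        omega
      exact ⟨k + 1, by rw [eP, h1, succ_nsmul'], by rw [eQ, h2, succ_nsmul']⟩
    · refine ⟨0, ?_, ?_⟩
      · rw [zero_smul]
        refine CurvePoint.ord_eq_zero_of_sub_pos hc ?_
        have := congrArg P.ord e
        rw [AddValuation.map_mul, AddValuation.map_mul, hPs, zero_add] at this
        rw [this]
        exact add_pos_of_pos_of_nonneg hPu (hPR g hg)
      · rw [zero_smul]
        refine CurvePoint.ord_eq_zero_of_sub_pos hc ?_
        have := congrArg Q.ord e
        rw [AddValuation.map_mul, AddValuation.map_mul, hQs, zero_add] at this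
        rw [this]
        exact add_pos_of_pos_of_nonneg hQu (hQR g hg)

/-- The orders of a function at two points over `(a, b)` are the same multiple of the orders of
`u`. -/
theorem exists_zpow (H : IsLocalParameter ξ η a b s u)
    (hPξ : 0 ≤ P.ord ξ) (hPη : 0 ≤ P.ord η) (hPs : P.ord s = 0) (hPu : 0 < P.ord u)
    (hQξ : 0 ≤ Q.ord ξ) (hQη : 0 ≤ Q.ord η) (hQs : Q.ord s = 0) (hQu : 0 < Q.ord u)
    {i j : ℤ} (hi : P.ord u = i) (hj : Q.ord u = j) {g : F} (hg : g ≠ 0) :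
    ∃ k : ℤ, P.ord g = ((k * i : ℤ) : WithTop ℤ) ∧ Q.ord g = ((k * j : ℤ) : WithTop ℤ) := by
  have hR : ∀ h ∈ Algebra.adjoin K {ξ, η}, h ≠ 0 → ∃ k : ℤ,
      P.ord h = ((k * i : ℤ) : WithTop ℤ) ∧ Q.ord h = ((k * j : ℤ) : WithTop ℤ) := by
    intro h hh h0
    obtain ⟨n, hn⟩ := P.exists_ord_eq h0
    obtain ⟨k, h1, h2⟩ := H.exists_pow_of_mem hPs hPu hQs hQu
      (fun _ => CurvePoint.ord_nonneg_of_mem_adjoin hPξ hPη)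
      (fun _ => CurvePoint.ord_nonneg_of_mem_adjoin hQξ hQη) (n + 1).toNat h hh h0
      (by rw [hn]; norm_cast; omega)
    refine ⟨k, ?_, ?_⟩
    · rw [h1, hi]; norm_cast
    · rw [h2, hj]; norm_cast
  have hmem : g ∈ IntermediateField.adjoin K {ξ, η} := H.adjoin_eq_top ▸ IntermediateField.mem_top
  obtain ⟨r, hr, d, hd, rfl⟩ := IntermediateField.mem_adjoin_iff_div.mp hmem
  obtain ⟨hr0, hd0⟩ := div_ne_zero_iff.mp hg
  obtain ⟨k, h1, h2⟩ := hR r hr hr0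
  obtain ⟨k', h1', h2'⟩ := hR d hd hd0
  refine ⟨k - k', ?_, ?_⟩
  · rw [AddValuation.map_div, h1, h1', sub_mul]; rfl
  · rw [AddValuation.map_div, h2, h2', sub_mul]; rfl

/-- Since orders are normalized, `u` has order one at a point over `(a, b)`. -/
theorem ord_eq_one (H : IsLocalParameter ξ η a b s u)
    (hPξ : 0 ≤ P.ord ξ) (hPη : 0 ≤ P.ord η) (hPs : P.ord s = 0) (hPu : 0 < P.ord u) :
    P.ord u = 1 := by
  obtain ⟨g, hg⟩ := P.ord_surjective 1
  have hg0 : g ≠ 0 := by rintro rfl; simp at hg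
  have hu0 : u ≠ 0 := by
    rintro rfl
    obtain ⟨α, -, hα⟩ := H.left
    obtain ⟨β, -, hβ⟩ := H.right
    have hs0 : s ≠ 0 := by rintro rfl; simp at hPs
    have h1 : ξ ∈ (⊥ : IntermediateField K F) := by
      rw [sub_eq_zero.mp ((mul_eq_zero.mp (hα.trans (zero_mul _))).resolve_left hs0)]
      exact IntermediateField.algebraMap_mem _ _
    have h2 : η ∈ (⊥ : IntermediateField K F) := by
      rw [sub_eq_zero.mp ((mul_eq_zero.mp (hβ.trans (zero_mul _))).resolve_left hs0)]
      exact IntermediateField.algebraMap_mem _ _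
    have h3 : IntermediateField.adjoin K {ξ, η} ≤ ⊥ := by
      rw [IntermediateField.adjoin_le_iff]
      rintro z (rfl | rfl)
      exacts [h1, h2]
    rw [H.adjoin_eq_top] at h3
    obtain ⟨c, rfl⟩ := IntermediateField.mem_bot.mp (h3 (IntermediateField.mem_top (x := g)))
    have hc : c ≠ 0 := by rintro rfl; simp at hg0
    rw [P.ord_const c hc] at hg
    exact zero_ne_one hg
  obtain ⟨i, hi⟩ := P.exists_ord_eq hu0
  obtain ⟨k, h1, -⟩ := H.exists_zpow hPξ hPη hPs hPu hPξ hPη hPs hPu hi hi hg0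
  rw [hg] at h1
  rw [hi] at hPu ⊢
  norm_cast at *
  rw [mul_comm] at h1
  exact Int.eq_one_of_dvd_one hPu.le ⟨k, h1⟩

/-- A point is determined by the values of `ξ` and `η` there, as soon as the maximal ideal has a
generator. -/
theorem point_eq (H : IsLocalParameter ξ η a b s u)
    (hPξ : 0 ≤ P.ord ξ) (hPη : 0 ≤ P.ord η) (hPs : P.ord s = 0) (hPu : 0 < P.ord u)
    (hQξ : 0 ≤ Q.ord ξ) (hQη : 0 ≤ Q.ord η) (hQs : Q.ord s = 0) (hQu : 0 < Q.ord u) :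
    P = Q := by
  refine CurvePoint.ext_ord fun g => ?_
  by_cases hg : g = 0
  · simp [hg]
  obtain ⟨k, h1, h2⟩ := H.exists_zpow hPξ hPη hPs hPu hQξ hQη hQs hQu
    (i := 1) (j := 1) (H.ord_eq_one hPξ hPη hPs hPu) (H.ord_eq_one hQξ hQη hQs hQu) hg
  rw [h1, h2]

end IsLocalParameter

/-! ### Points from embeddings into a field of Laurent series -/

/-- With `p = c² (1 + q)`, a square root of `p` is `c` times the binomial series
`(1 + q) ^ (1 / 2)`. -/
theorem PowerSeries.exists_sq_eq {K : Type*} [Field K] [CharZero K] [IsAlgClosed K]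
    (p : PowerSeries K) (hp : PowerSeries.constantCoeff p ≠ 0) : ∃ s : PowerSeries K, s ^ 2 = p := by
  obtain ⟨c, hc⟩ := IsAlgClosed.exists_pow_nat_eq (PowerSeries.constantCoeff p) two_pos
  set q : PowerSeries K := PowerSeries.C (PowerSeries.constantCoeff p)⁻¹ * p - 1 with hq
  have hq0 : PowerSeries.HasSubst q :=
    PowerSeries.HasSubst.of_constantCoeff_zero' (by simp [hq, hp])
  have h2 : PowerSeries.binomialSeries K (1 / 2 : ℚ) ^ 2 = 1 + PowerSeries.X := by
    rw [sq, ← PowerSeries.binomialSeries_add]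
    have := PowerSeries.binomialSeries_nat (R := ℚ) (A := K) 1
    norm_num at this ⊢
    exact this
  refine ⟨PowerSeries.C c *
    PowerSeries.substAlgHom hq0 (PowerSeries.binomialSeries K (1 / 2 : ℚ)), ?_⟩
  rw [mul_pow, ← map_pow, ← map_pow, h2, map_add, map_one, PowerSeries.coe_substAlgHom,
    PowerSeries.subst_X hq0, hc, hq, add_sub_cancel, ← mul_assoc, ← map_mul, mul_inv_cancel₀ hp,
    map_one, one_mul]

namespace LaurentSeries

variable {K : Type*} [Field K]

theorem addVal_coe_nonneg (p : PowerSeries K) :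
    0 ≤ HahnSeries.addVal ℤ K (HahnSeries.ofPowerSeries ℤ K p) := by
  rw [HahnSeries.addVal_apply]
  refine HahnSeries.le_orderTop_iff_forall.mpr fun i hi => ?_
  rw [PowerSeries.coeff_coe, if_pos (by exact_mod_cast hi)]

theorem addVal_coe_eq_zero {p : PowerSeries K} (hp : PowerSeries.constantCoeff p ≠ 0) :
    HahnSeries.addVal ℤ K (HahnSeries.ofPowerSeries ℤ K p) = 0 := by
  obtain ⟨q, hq⟩ := (PowerSeries.isUnit_iff_constantCoeff.mpr hp.isUnit).exists_right_inv
  have h := congrArg (fun r => HahnSeries.addVal ℤ K (HahnSeries.ofPowerSeries ℤ K r)) hq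
  simp only [map_mul, map_one, AddValuation.map_mul, AddValuation.map_one] at h
  exact le_antisymm (h ▸ le_add_of_nonneg_right (addVal_coe_nonneg q)) (addVal_coe_nonneg p)

theorem addVal_coe_pos {p : PowerSeries K} (hp : PowerSeries.constantCoeff p = 0) :
    0 < HahnSeries.addVal ℤ K (HahnSeries.ofPowerSeries ℤ K p) := by
  obtain ⟨q, rfl⟩ := PowerSeries.X_dvd_iff.mpr hp
  rw [map_mul, AddValuation.map_mul, HahnSeries.ofPowerSeries_X, HahnSeries.addVal_apply,
    HahnSeries.orderTop_single one_ne_zero]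
  exact add_pos_of_pos_of_nonneg (by exact_mod_cast one_pos) (addVal_coe_nonneg q)

/-- Power series as Laurent series, as a homomorphism of `K`-algebras. -/
def coeAlgHom : PowerSeries K →ₐ[K] LaurentSeries K where
  __ := HahnSeries.ofPowerSeries ℤ K
  commutes' c := by
    rw [LaurentSeries.algebraMap_apply]
    exact HahnSeries.ofPowerSeries_C c

theorem coeAlgHom_apply (p : PowerSeries K) : coeAlgHom p = HahnSeries.ofPowerSeries ℤ K p := rfl

theorem coeAlgHom_injective : Function.Injective (coeAlgHom (K := K)) :=
  HahnSeries.ofPowerSeries_injective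

theorem addVal_algebraMap {c : K} (hc : c ≠ 0) :
    HahnSeries.addVal ℤ K (algebraMap K (LaurentSeries K) c) = 0 := by
  rw [← AlgHom.commutes coeAlgHom c]
  exact addVal_coe_eq_zero (by simpa using hc)

theorem transcendental_coeAlgHom_X : Transcendental K (coeAlgHom (PowerSeries.X : PowerSeries K)) := by
  rw [transcendental_iff_injective]
  have h : (Polynomial.aeval (coeAlgHom (PowerSeries.X : PowerSeries K))) =
      coeAlgHom.comp (Polynomial.coeToPowerSeries.algHom K) := by
    ext1
    simp
  rw [h]
  refine coeAlgHom_injective.comp fun p q hpq => Polynomial.coe_injective K ?_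
  simpa [Polynomial.coeToPowerSeries.algHom_apply] using hpq

end LaurentSeries

namespace CurvePoint

variable {K F : Type*} [Field K] [Field F] [Algebra K F]

/-- The point cut out by an embedding of the function field into `K((T))` whose image contains a
series of order one. -/
def ofAlgHom (ψ : F →ₐ[K] LaurentSeries K) (hψ : ∃ g, HahnSeries.addVal ℤ K (ψ g) = 1) :
    CurvePoint K F where
  ord := (HahnSeries.addVal ℤ K).comap ψ.toRingHom
  ord_const c hc := by
    change HahnSeries.addVal ℤ K (ψ (algebraMap K F c)) = 0
    rw [AlgHom.commutes]
    exact LaurentSeries.addVal_algebraMap hc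
  ord_surjective n := by
    obtain ⟨g, hg⟩ := hψ
    change ∃ h, HahnSeries.addVal ℤ K (ψ h) = n
    induction n using WithTop.recTopCoe with
    | top => exact ⟨0, by simp⟩
    | coe n =>
      rcases Int.eq_nat_or_neg n with ⟨k, rfl | rfl⟩
      · exact ⟨g ^ k, by rw [map_pow, AddValuation.map_pow, hg]; norm_cast; simp⟩
      · refine ⟨(g ^ k)⁻¹, ?_⟩
        rw [map_inv₀, map_pow, AddValuation.map_inv, AddValuation.map_pow, hg]
        norm_cast
        simp

theorem ofAlgHom_ord (ψ : F →ₐ[K] LaurentSeries K)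
    (hψ : ∃ g, HahnSeries.addVal ℤ K (ψ g) = 1) (g : F) :
    (ofAlgHom ψ hψ).ord g = HahnSeries.addVal ℤ K (ψ g) := rfl

end CurvePoint

/-! ### The function field of a hyperelliptic curve -/

namespace HyperellipticCurve

open Polynomial

variable {k : Type*} [Field k] [CharZero k] (C : HyperellipticCurve k)

/-- The coordinate function `x`. -/
def x : C.FunctionField := AdjoinRoot.of _ RatFunc.X

/-- The coordinate function `y`. -/
def y : C.FunctionField := AdjoinRoot.root _

/-- The polynomial `f` over the algebraic closure. -/
abbrev fbar : (AlgebraicClosure k)[X] := C.f.map (algebraMap k (AlgebraicClosure k))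

theorem of_algebraMap (p : (AlgebraicClosure k)[X]) :
    (AdjoinRoot.of (X ^ 2 - Polynomial.C C.rhs) (algebraMap _ (RatFunc (AlgebraicClosure k)) p)) =
      aeval C.x p := by
  have : ((Algebra.ofId (RatFunc (AlgebraicClosure k)) C.FunctionField).restrictScalars
      (AlgebraicClosure k)).comp (IsScalarTower.toAlgHom (AlgebraicClosure k)
        (AlgebraicClosure k)[X] (RatFunc (AlgebraicClosure k))) = aeval C.x := by
    ext1
    simp [x]
  exact DFunLike.congr_fun this p

theorem y_sq : C.y ^ 2 = aeval C.x C.fbar := by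
  have h := AdjoinRoot.eval₂_root (X ^ 2 - Polynomial.C C.rhs)
  rw [eval₂_sub, eval₂_X_pow, eval₂_C, sub_eq_zero] at h
  rw [← C.of_algebraMap]
  exact h

theorem adjoin_x_y : IntermediateField.adjoin (AlgebraicClosure k) {C.x, C.y} = ⊤ := by
  rw [eq_top_iff]
  rintro g -
  have hx : C.x ∈ IntermediateField.adjoin (AlgebraicClosure k) {C.x, C.y} :=
    IntermediateField.subset_adjoin _ _ (by simp)
  have hy : C.y ∈ IntermediateField.adjoin (AlgebraicClosure k) {C.x, C.y} :=
    IntermediateField.subset_adjoin _ _ (by simp)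
  have hp (p : (AlgebraicClosure k)[X]) :
      aeval C.x p ∈ IntermediateField.adjoin (AlgebraicClosure k) {C.x, C.y} :=
    IntermediateField.algebra_adjoin_le_adjoin _ _
      (Algebra.adjoin_mono (by simp) (aeval_mem_adjoin_singleton _ _))
  have hr (r : RatFunc (AlgebraicClosure k)) : AdjoinRoot.of (X ^ 2 - Polynomial.C C.rhs) r ∈
      IntermediateField.adjoin (AlgebraicClosure k) {C.x, C.y} := by
    rw [← RatFunc.num_div_denom r, map_div₀, of_algebraMap, of_algebraMap]
    exact div_mem (hp _) (hp _)
  induction g using AdjoinRoot.induction_on with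
  | ih q =>
    induction q using Polynomial.induction_on' with
    | add p q hp hq => rw [map_add]; exact add_mem hp hq
    | monomial n r =>
      rw [← C_mul_X_pow_eq_monomial, map_mul, map_pow]
      exact mul_mem (hr r) (pow_mem hy n)

theorem aeval_x_injective : Function.Injective (aeval C.x : (AlgebraicClosure k)[X] → _) := by
  intro p q h
  rw [← of_algebraMap, ← of_algebraMap] at h
  exact RatFunc.algebraMap_injective _ ((AdjoinRoot.of _).injective h)

/-- Every function is `A + B y` with `A` and `B` rational functions of `x`. -/
theorem exists_eq_add_mul_y (g : C.FunctionField) :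
    ∃ A B : RatFunc (AlgebraicClosure k),
      g = AdjoinRoot.of _ A + AdjoinRoot.of _ B * C.y := by
  induction g using AdjoinRoot.induction_on with
  | ih q =>
    induction q using Polynomial.induction_on' with
    | add p q hp hq =>
      obtain ⟨A, B, h⟩ := hp
      obtain ⟨A', B', h'⟩ := hq
      refine ⟨A + A', B + B', ?_⟩
      rw [map_add, h, h', map_add, map_add]
      ring
    | monomial n r =>
      rw [← C_mul_X_pow_eq_monomial, map_mul, map_pow, AdjoinRoot.mk_X, AdjoinRoot.mk_C]
      have hy : AdjoinRoot.root (X ^ 2 - Polynomial.C C.rhs) ^ 2 = AdjoinRoot.of _ C.rhs :=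
        C.y_sq.trans (C.of_algebraMap _).symm
      rcases Nat.even_or_odd' n with ⟨j, rfl | rfl⟩
      · refine ⟨r * C.rhs ^ j, 0, ?_⟩
        rw [pow_mul, hy, map_mul, map_pow, map_zero, zero_mul, add_zero]
      · refine ⟨0, r * C.rhs ^ j, ?_⟩
        rw [pow_succ (AdjoinRoot.root _) (2 * j), pow_mul, hy, map_mul, map_pow, map_zero, zero_add, mul_assoc]
        rfl

theorem involution_of (r : RatFunc (AlgebraicClosure k)) :
    C.involution.toRingEquiv (AdjoinRoot.of _ r) = AdjoinRoot.of _ r :=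
  AdjoinRoot.lift_of C.eval₂_neg_root

theorem involution_x : C.involution.toRingEquiv C.x = C.x := C.involution_of _

theorem involution_y : C.involution.toRingEquiv C.y = -C.y :=
  AdjoinRoot.lift_root C.eval₂_neg_root

theorem involution_algebraMap (c : AlgebraicClosure k) :
    C.involution.toRingEquiv (algebraMap _ _ c) = algebraMap _ _ c := C.involution.map_const c

theorem galAut_x (σ : AlgebraicClosure k ≃ₐ[k] AlgebraicClosure k) :
    (C.galAut σ).toRingEquiv C.x = C.x := by
  simp only [galAut, x]
  rw [AdjoinRoot.coe_mapRingEquiv, AdjoinRoot.map_of, ← RatFunc.algebraMap_X]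
  simp only [RingHom.coe_coe]
  rw [ratFuncAut_algebraMap, Polynomial.map_X, RatFunc.algebraMap_X]

theorem galAut_y (σ : AlgebraicClosure k ≃ₐ[k] AlgebraicClosure k) :
    (C.galAut σ).toRingEquiv C.y = C.y := by
  simp only [galAut, y]
  rw [AdjoinRoot.coe_mapRingEquiv, AdjoinRoot.map_root]

theorem galAut_ratCast (σ : AlgebraicClosure k ≃ₐ[k] AlgebraicClosure k) (q : ℚ) :
    (C.galAut σ).toRingEquiv (algebraMap _ _ (q : AlgebraicClosure k)) =
      algebraMap _ _ (q : AlgebraicClosure k) := by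
  rw [(C.galAut σ).map_const, map_ratCast]

end HyperellipticCurve

/-! ### Polynomials in the parameter of a Laurent series field -/

namespace LaurentSeries

variable {K : Type*} [Field K]

/-- Polynomials in `T` as Laurent series. -/
def polyHom : Polynomial K →ₐ[K] LaurentSeries K :=
  coeAlgHom.comp (Polynomial.coeToPowerSeries.algHom K)

theorem polyHom_apply (p : Polynomial K) :
    polyHom p = HahnSeries.ofPowerSeries ℤ K (p : PowerSeries K) := by
  simp [polyHom, coeAlgHom_apply, Polynomial.coeToPowerSeries.algHom_apply]

theorem transcendental_polyHom_X : Transcendental K (polyHom (Polynomial.X : Polynomial K)) := by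
  rw [polyHom_apply, Polynomial.coe_X]
  exact transcendental_coeAlgHom_X

/-- If `T ^ n + a` were algebraic, so would be `T ^ n`, hence `T`. -/
theorem transcendental_polyHom {n : ℕ} (hn : 0 < n) (a : K) :
    Transcendental K (polyHom (Polynomial.X ^ n + Polynomial.C a : Polynomial K)) := by
  intro h
  refine (transcendental_polyHom_X (K := K)).pow hn ?_
  have h1 : polyHom (Polynomial.X : Polynomial K) ^ n =
      polyHom (Polynomial.X ^ n + Polynomial.C a) - algebraMap K _ a := by
    rw [map_add, map_pow, ← Polynomial.algebraMap_eq, AlgHom.commutes, add_sub_cancel_right]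
  rw [h1]
  exact h.sub (isAlgebraic_algebraMap a)

theorem addVal_polyHom_X : HahnSeries.addVal ℤ K (polyHom Polynomial.X) = 1 := by
  rw [polyHom_apply, Polynomial.coe_X, HahnSeries.ofPowerSeries_X, HahnSeries.addVal_apply,
    HahnSeries.orderTop_single one_ne_zero]
  rfl

/-- The square root is normalized by its constant term `b`. -/
theorem exists_sq_eq_polyHom [CharZero K] [IsAlgClosed K] (q : Polynomial K) {b : K} (hb : b ≠ 0)
    (hq : b ^ 2 = q.eval 0) :
    ∃ p : PowerSeries K, PowerSeries.constantCoeff p = b ∧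
      HahnSeries.ofPowerSeries ℤ K p ^ 2 = polyHom q := by
  have hq0 : PowerSeries.constantCoeff (q : PowerSeries K) = b ^ 2 := by
    rw [Polynomial.constantCoeff_coe, Polynomial.coeff_zero_eq_eval_zero, hq]
  obtain ⟨p, hp⟩ := PowerSeries.exists_sq_eq (q : PowerSeries K) (by simp [hq0, hb])
  have h := congrArg PowerSeries.constantCoeff hp
  rw [map_pow, hq0] at h
  rcases sq_eq_sq_iff_eq_or_eq_neg.mp h with h | h
  · exact ⟨p, h, by rw [← map_pow, hp, polyHom_apply]⟩
  · exact ⟨-p, by rw [map_neg, h, neg_neg], by rw [← map_pow, neg_sq, hp, polyHom_apply]⟩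

end LaurentSeries

/-! ### Existence of points -/

namespace HyperellipticCurve

open Polynomial LaurentSeries

variable {k : Type*} [Field k] [CharZero k] (C : HyperellipticCurve k)

/-- A solution of `s² = f(x₀)` in Laurent series with `x₀` nonconstant embeds the function field. -/
theorem exists_algHom {x₀ s : LaurentSeries (AlgebraicClosure k)}
    (hx : Transcendental (AlgebraicClosure k) x₀) (hs : s ^ 2 = aeval x₀ C.fbar) :
    ∃ ψ : C.FunctionField →ₐ[AlgebraicClosure k] LaurentSeries (AlgebraicClosure k),
      ψ C.x = x₀ ∧ ψ C.y = s := by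
  have hinj := transcendental_iff_injective.mp hx
  let φ : RatFunc (AlgebraicClosure k) →ₐ[AlgebraicClosure k] LaurentSeries (AlgebraicClosure k) :=
    RatFunc.liftAlgHom (aeval x₀) (nonZeroDivisors_le_comap_nonZeroDivisors_of_injective _ hinj)
  have hφ (p : (AlgebraicClosure k)[X]) : φ (algebraMap _ _ p) = aeval x₀ p := by
    have := RatFunc.liftAlgHom_apply_div (aeval x₀)
      (nonZeroDivisors_le_comap_nonZeroDivisors_of_injective _ hinj) p 1
    simpa using this
  have h0 : (X ^ 2 - Polynomial.C C.rhs).eval₂ (φ : _ →+* LaurentSeries (AlgebraicClosure k)) s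
      = 0 := by
    rw [eval₂_sub, eval₂_X_pow, eval₂_C, sub_eq_zero, hs]
    exact (hφ _).symm
  refine ⟨AdjoinRoot.liftAlgHom _ φ s h0, ?_, ?_⟩
  · rw [x, AdjoinRoot.liftAlgHom_of, ← RatFunc.algebraMap_X, hφ, aeval_X]
  · rw [y, AdjoinRoot.liftAlgHom_root]

theorem aeval_polyHom (p : (AlgebraicClosure k)[X]) :
    aeval (polyHom p) C.fbar = polyHom (C.fbar.comp p) := by
  rw [aeval_algHom_apply]
  rfl

/-- The points outside the ramification of `x`, where `x - a` is a local parameter. -/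
theorem exists_point_of_ne_zero {a b : AlgebraicClosure k} (hb : b ≠ 0)
    (h : b ^ 2 = C.fbar.eval a) :
    ∃ Q : C.GeomPoint, 0 < Q.ord (C.x - algebraMap _ _ a) ∧ 0 < Q.ord (C.y - algebraMap _ _ b) := by
  obtain ⟨p, hpb, hp⟩ := exists_sq_eq_polyHom (C.fbar.comp (X ^ 1 + Polynomial.C a)) hb
    (by rw [h]; simp)
  obtain ⟨ψ, hx, hy⟩ := C.exists_algHom (transcendental_polyHom one_pos a)
    (by rw [aeval_polyHom]; exact hp)
  have h1 : HahnSeries.addVal ℤ _ (ψ (C.x - algebraMap _ _ a)) = 1 := by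
    rw [map_sub, hx, AlgHom.commutes, map_add, ← Polynomial.algebraMap_eq, AlgHom.commutes,
      add_sub_cancel_right, pow_one, addVal_polyHom_X]
  refine ⟨CurvePoint.ofAlgHom ψ ⟨_, h1⟩, ?_, ?_⟩
  · rw [CurvePoint.ofAlgHom_ord, h1]
    exact zero_lt_one
  · rw [CurvePoint.ofAlgHom_ord, map_sub, hy, AlgHom.commutes, ← AlgHom.commutes coeAlgHom,
      coeAlgHom_apply, ← map_sub]
    exact addVal_coe_pos (by simp [hpb])

/-- The affine ramification points of `x`, where `y` is a local parameter. -/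
theorem exists_point_of_root {a : AlgebraicClosure k} (h : C.fbar.eval a = 0) :
    ∃ Q : C.GeomPoint, Q.ord (C.x - algebraMap _ _ a) = 2 ∧ Q.ord C.y = 1 := by
  obtain ⟨q, hq⟩ := dvd_iff_isRoot.mpr h
  have hqa : q.eval a ≠ 0 := by
    intro h0
    obtain ⟨r, hr⟩ := dvd_iff_isRoot.mpr h0
    have hsq : Squarefree C.fbar := (C.separable.map).squarefree
    exact not_isUnit_X_sub_C a (hsq _ ⟨r, by rw [hq, hr, mul_assoc]⟩)
  obtain ⟨c, hc⟩ := IsAlgClosed.exists_pow_nat_eq (q.eval a) two_pos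
  have hc0 : c ≠ 0 := by rintro rfl; exact hqa (by rw [← hc]; simp)
  obtain ⟨p, hpc, hp⟩ := exists_sq_eq_polyHom (q.comp (X ^ 2 + Polynomial.C a)) hc0
    (by rw [hc]; simp)
  obtain ⟨ψ, hx, hy⟩ := C.exists_algHom (transcendental_polyHom two_pos a)
    (s := polyHom X * HahnSeries.ofPowerSeries ℤ _ p) (by
      rw [aeval_polyHom, mul_pow, hp, hq, mul_comp, map_mul, sub_comp, X_comp, C_comp,
        add_sub_cancel_right, map_pow])
  have h1 : HahnSeries.addVal ℤ _ (ψ C.y) = 1 := by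
    rw [hy, AddValuation.map_mul, addVal_polyHom_X, addVal_coe_eq_zero (hpc ▸ hc0), add_zero]
  refine ⟨CurvePoint.ofAlgHom ψ ⟨_, h1⟩, ?_, h1⟩
  rw [CurvePoint.ofAlgHom_ord, map_sub, hx, AlgHom.commutes, map_add, ← Polynomial.algebraMap_eq,
    AlgHom.commutes, add_sub_cancel_right, map_pow, AddValuation.map_pow, addVal_polyHom_X]
  norm_num

/-- When `f` is monic of even degree `2n`, a point at infinity at which `y / x ^ n` has value `1`. -/
theorem exists_point_infinity {n : ℕ} (hdeg : C.f.natDegree = 2 * n) (hmon : C.f.Monic) :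
    ∃ Q : C.GeomPoint, Q.ord C.x⁻¹ = 1 ∧ 0 < Q.ord (C.y * C.x⁻¹ ^ n - 1) := by
  have hmon' : C.fbar.Monic := hmon.map _
  have hdeg' : C.fbar.natDegree = 2 * n := by rw [natDegree_map, hdeg]
  obtain ⟨p, hp1, hp⟩ := exists_sq_eq_polyHom C.fbar.reverse one_ne_zero
    (by rw [← coeff_zero_eq_eval_zero, coeff_zero_reverse, hmon'.leadingCoeff, one_pow])
  have hT : (polyHom X : LaurentSeries (AlgebraicClosure k)) ≠ 0 := by
    intro h0
    have := addVal_polyHom_X (K := AlgebraicClosure k)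
    rw [h0] at this
    simp at this
  have hrev : aeval (polyHom X : LaurentSeries (AlgebraicClosure k))⁻¹ C.fbar =
      polyHom C.fbar.reverse * (polyHom X)⁻¹ ^ (2 * n) := by
    have := invertibleOfNonzero (inv_ne_zero hT)
    have := eval₂_reverse_mul_pow (algebraMap (AlgebraicClosure k) _)
      (polyHom X : LaurentSeries (AlgebraicClosure k))⁻¹ C.fbar
    rw [invOf_eq_inv, inv_inv, hdeg'] at this
    rw [aeval_def, ← this, ← aeval_def, aeval_algHom_apply, aeval_X_left_apply]
  obtain ⟨ψ, hx, hy⟩ := C.exists_algHom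
    (x₀ := (polyHom X : LaurentSeries (AlgebraicClosure k))⁻¹)
    (s := HahnSeries.ofPowerSeries ℤ _ p * (polyHom X)⁻¹ ^ n)
    (fun h => transcendental_polyHom_X (by simpa using h.inv))
    (by rw [hrev, mul_pow, hp, ← pow_mul, mul_comm n])
  have h1 : HahnSeries.addVal ℤ _ (ψ C.x⁻¹) = 1 := by
    rw [map_inv₀, hx, inv_inv, addVal_polyHom_X]
  refine ⟨CurvePoint.ofAlgHom ψ ⟨_, h1⟩, h1, ?_⟩
  rw [CurvePoint.ofAlgHom_ord, map_sub, map_mul, map_pow, map_inv₀, hx, hy, inv_inv, mul_assoc,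
    ← mul_pow, inv_mul_cancel₀ hT, one_pow, mul_one, map_one,
    ← map_one (HahnSeries.ofPowerSeries ℤ (AlgebraicClosure k)), ← map_sub]
  exact addVal_coe_pos (by simp [hp1])

end HyperellipticCurve

/-! ### Functions with small poles at infinity -/

namespace CurvePoint

open Polynomial

variable {K F : Type*} [Field K] [Field F] [Algebra K F] {P : CurvePoint K F}

theorem ord_aeval_nonneg {x : F} (hx : 0 ≤ P.ord x) (p : K[X]) : 0 ≤ P.ord (aeval x p) := by
  have : ((aeval (⟨x, hx⟩ : P.integers) p : P.integers) : F) ∈ P.integers := SetLike.coe_mem _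
  rwa [← Subalgebra.aeval_coe] at this

theorem ord_nonneg_of_sub_pos {x : F} {a : K} (hx : 0 < P.ord (x - algebraMap K F a)) :
    0 ≤ P.ord x := by
  have := P.ord.map_le_add hx.le (P.ord_algebraMap_nonneg a)
  rwa [sub_add_cancel] at this

theorem ord_sub_le_ord_aeval {x : F} {a : K} (hx : 0 < P.ord (x - algebraMap K F a)) {p : K[X]}
    (hp : p.IsRoot a) : P.ord (x - algebraMap K F a) ≤ P.ord (aeval x p) := by
  obtain ⟨q, rfl⟩ := dvd_iff_isRoot.mpr hp
  rw [map_mul, AddValuation.map_mul, map_sub (aeval (R := K) x), aeval_X, aeval_C]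
  exact le_add_of_nonneg_right (ord_aeval_nonneg (ord_nonneg_of_sub_pos hx) q)

theorem ord_aeval_eq_zero {x : F} {a : K} (hx : 0 < P.ord (x - algebraMap K F a)) {p : K[X]}
    (hp : p.eval a ≠ 0) : P.ord (aeval x p) = 0 := by
  refine ord_eq_zero_of_sub_pos hp ?_
  have h := ord_sub_le_ord_aeval hx (p := p - Polynomial.C (p.eval a)) (by simp)
  rw [map_sub (aeval (R := K) x), aeval_C] at h
  exact hx.trans_le h

/-- A nonzero polynomial in `x` does not vanish at a pole of `x`. -/
theorem ord_aeval_nonpos {x : F} (hx : P.ord x < 0) {p : K[X]} (hp : p ≠ 0) :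
    P.ord (aeval x p) ≤ 0 := by
  have key : ∀ p : K[X], p ≠ 0 →
      P.ord (aeval x p) ≤ 0 ∧ (p.coeff 0 = 0 → P.ord (aeval x p) < 0) := by
    intro p
    induction p using Polynomial.recOnHorner with
    | M0 => exact fun h => absurd rfl h
    | MC p a hp0 ha ih =>
      intro _
      refine ⟨?_, fun h => absurd h (by simp [hp0, ha])⟩
      rw [map_add, aeval_C]
      by_cases hp : p = 0
      · rw [hp, map_zero, zero_add, P.ord_const a ha]
      · have h1 := (ih hp).2 hp0
        rw [P.ord.map_add_eq_of_lt_left (by rwa [P.ord_const a ha])]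
        exact h1.le
    | MX p hp ih =>
      intro _
      have h : P.ord (aeval x (p * X)) < 0 := by
        rw [map_mul, aeval_X, AddValuation.map_mul]
        exact (add_le_of_nonpos_left (ih hp).1).trans_lt hx
      exact ⟨h.le, fun _ => h⟩
  exact (key p hp).1

end CurvePoint

namespace HyperellipticCurve

open Polynomial

variable {k : Type*} [Field k] [CharZero k] (C : HyperellipticCurve k)

theorem x_ne_zero : C.x ≠ 0 := by
  intro h
  have := C.aeval_x_injective (a₁ := X) (a₂ := 0) (by simp [h])
  exact X_ne_zero this

theorem ord_involution (Q : C.GeomPoint) (g : C.FunctionField) :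
    Q.ord (C.involution.toRingEquiv g) = (C.involution.pointMap Q).ord g := rfl

/-- Above every `a` there is a point at which `y` vanishes to lower order than `x - a`. -/
theorem exists_point_over (a : AlgebraicClosure k) :
    ∃ Q : C.GeomPoint, 0 ≤ Q.ord C.y ∧ Q.ord C.y < Q.ord (C.x - algebraMap _ _ a) := by
  by_cases ha : C.fbar.eval a = 0
  · obtain ⟨Q, h1, h2⟩ := C.exists_point_of_root ha
    refine ⟨Q, ?_, ?_⟩
    · rw [h2]; exact zero_le_one
    · rw [h1, h2]; exact_mod_cast one_lt_two
  · obtain ⟨b, hb⟩ := IsAlgClosed.exists_pow_nat_eq (C.fbar.eval a) two_pos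
    have hb0 : b ≠ 0 := by rintro rfl; exact ha (by rw [← hb]; simp)
    obtain ⟨Q, h1, h2⟩ := C.exists_point_of_ne_zero hb0 hb
    have h3 := CurvePoint.ord_eq_zero_of_sub_pos hb0 h2
    exact ⟨Q, h3.ge, h3 ▸ h1⟩

/-- A function without affine poles whose poles at infinity have order less than `n`, where
`deg f = 2n`, is a function of `x` alone: its `y`-part `B y` also has these properties, so `B` is
a polynomial, but `y` has poles of order `n` at infinity. -/
theorem involution_eq_self_of_small_poles {n : ℕ} (hdeg : C.f.natDegree = 2 * n)
    (hmon : C.f.Monic) {g : C.FunctionField}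
    (hfin : ∀ Q : C.GeomPoint, 0 ≤ Q.ord C.x → 0 ≤ Q.ord g)
    (hinf : ∀ Q : C.GeomPoint, Q.ord C.x < 0 → ((-n : ℤ) : WithTop ℤ) < Q.ord g) :
    C.involution.toRingEquiv g = g := by
  obtain ⟨A, B, hg⟩ := C.exists_eq_add_mul_y g
  have hι : C.involution.toRingEquiv g = AdjoinRoot.of _ A - AdjoinRoot.of _ B * C.y := by
    rw [hg, map_add, map_mul, involution_of, involution_of, involution_y, mul_neg]
    ring
  have hx (Q : C.GeomPoint) : (C.involution.pointMap Q).ord C.x = Q.ord C.x := by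
    rw [← ord_involution, involution_x]
  -- `z = 2 B y` has the same bounds on its poles as `g`.
  set z := g - C.involution.toRingEquiv g with hz
  have hzB : z * aeval C.x B.denom = algebraMap (AlgebraicClosure k) _ 2 * aeval C.x B.num * C.y := by
    have hd : aeval C.x B.denom ≠ 0 := by
      rw [← map_zero (aeval (R := AlgebraicClosure k) C.x)]
      exact C.aeval_x_injective.ne B.denom_ne_zero
    have hB : AdjoinRoot.of (X ^ 2 - Polynomial.C C.rhs) B * aeval C.x B.denom =
        aeval C.x B.num := by
      rw [← of_algebraMap, ← of_algebraMap, ← map_mul]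
      congr 1
      nth_rw 1 [← RatFunc.num_div_denom B]
      exact div_mul_cancel₀ _ (by simpa using B.denom_ne_zero)
    rw [hz, hι, hg, map_ofNat]
    linear_combination 2 * C.y * hB
  have hzfin (Q : C.GeomPoint) (hQ : 0 ≤ Q.ord C.x) : 0 ≤ Q.ord z :=
    Q.ord.map_le_sub (hfin Q hQ) (hfin (C.involution.pointMap Q) (by rwa [hx]))
  have hzinf (Q : C.GeomPoint) (hQ : Q.ord C.x < 0) : ((-n : ℤ) : WithTop ℤ) < Q.ord z := by
    refine lt_of_lt_of_le (lt_min (hinf Q hQ) ?_) (Q.ord.map_sub _ _)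
    exact hinf (C.involution.pointMap Q) (by rwa [hx])
  -- A root `a` of the denominator of `B` gives a pole of `B y` over `x = a`, because `y` vanishes
  -- there to lower order than `x - a`.
  have hdenom : B.denom = 1 := by
    by_contra hne
    have hdeg0 : B.denom.degree ≠ 0 := fun h0 =>
      hne ((RatFunc.monic_denom B).natDegree_eq_zero.mp (natDegree_eq_zero_iff_degree_le_zero.mpr h0.le))
    obtain ⟨a, ha⟩ := IsAlgClosed.exists_root B.denom hdeg0
    have hna : B.num.eval a ≠ 0 := fun h0 => by
      obtain ⟨u, v, huv⟩ := RatFunc.isCoprime_num_denom B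
      have := congrArg (eval a) huv
      rw [eval_add, eval_mul, eval_mul, h0, ha.eq_zero] at this
      simp at this
    obtain ⟨Q, h1, h2⟩ := C.exists_point_over a
    have hpos := h1.trans_lt h2
    have e := congrArg Q.ord hzB
    rw [AddValuation.map_mul, AddValuation.map_mul, AddValuation.map_mul,
      Q.ord_const 2 two_ne_zero, CurvePoint.ord_aeval_eq_zero hpos hna, zero_add, zero_add] at e
    have h3 := CurvePoint.ord_sub_le_ord_aeval hpos ha
    have h4 := hzfin Q (CurvePoint.ord_nonneg_of_sub_pos hpos)
    exact absurd ((h3.trans (le_add_of_nonneg_left h4)).trans e.le) (not_le.mpr h2)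
  rw [hdenom, map_one, mul_one] at hzB
  by_cases hB : B.num = 0
  · rw [hB, map_zero, mul_zero, zero_mul] at hzB
    exact (sub_eq_zero.mp (hz.symm.trans hzB)).symm
  -- At infinity a nonzero polynomial `B` has no zero and `y` has a pole of order `n`.
  obtain ⟨Q, h1, h2⟩ := C.exists_point_infinity hdeg hmon
  have hy1 : Q.ord (C.y * C.x⁻¹ ^ n) = 0 :=
    CurvePoint.ord_eq_zero_of_sub_pos one_ne_zero (by rwa [map_one])
  have hxneg : Q.ord C.x < 0 := by rw [CurvePoint.ord_eq_neg_one_of_inv h1]; norm_cast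
  have h3 := hzinf Q hxneg
  have h4 := CurvePoint.ord_aeval_nonpos hxneg hB
  rw [hzB, AddValuation.map_mul, AddValuation.map_mul, Q.ord_const 2 two_ne_zero, zero_add] at h3
  have h5 : Q.ord C.y = ((-n : ℤ) : WithTop ℤ) := by
    rw [AddValuation.map_mul, AddValuation.map_pow, h1] at hy1
    have hy0 : C.y ≠ 0 := by rintro h; rw [h] at hy1; simp at hy1
    obtain ⟨j, hj⟩ := Q.exists_ord_eq hy0
    rw [hj, nsmul_one] at hy1
    have h : j + n = 0 := by exact_mod_cast hy1
    rw [hj, eq_neg_of_add_eq_zero_left h]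
  rw [h5] at h3
  exact absurd (h3.trans_le (add_le_add_left h4 _)) (by simp)

end HyperellipticCurve

/-! ### Orders of functions and the Galois action -/

namespace HyperellipticCurve

open Polynomial

variable {k : Type*} [Field k] [CharZero k] (C : HyperellipticCurve k)

theorem ord_galAut (σ : AlgebraicClosure k ≃ₐ[k] AlgebraicClosure k) (Q : C.GeomPoint)
    {g : C.FunctionField} (hg : (C.galAut σ).toRingEquiv g = g) :
    ((C.galAut σ).pointMap Q).ord g = Q.ord g := by
  rw [SemilinearAut.ord_pointMap, (RingEquiv.symm_apply_eq _).mpr hg.symm]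

theorem ord_y_nonneg {Q : C.GeomPoint} (hx : 0 ≤ Q.ord C.x) : 0 ≤ Q.ord C.y := by
  have h := CurvePoint.ord_aeval_nonneg hx C.fbar
  rw [← y_sq] at h
  exact CurvePoint.ord_nonneg_of_sq h

end HyperellipticCurve

namespace yamamotoCurve

open Polynomial HyperellipticCurve

variable (l : ℚ) (hl : l ≠ 0) (hl1 : l ^ 2 ≠ 1) (m : ℕ) (hm : 1 < m)

local notation "𝒞" => yamamotoCurve l hl hl1 m hm
local notation "𝕂" => AlgebraicClosure ℚ
local notation "ℓ" => (l : AlgebraicClosure ℚ)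

/-! ### The curve `y² = (x ^ m - 1) (x ^ m - λ²)` -/

theorem natDegree_f : (𝒞).f.natDegree = 2 * m := by
  change (X ^ (2 * m) - C (1 + l ^ 2) * X ^ m + C (l ^ 2) : ℚ[X]).natDegree = 2 * m
  compute_degree!
  · rw [if_neg (by omega), if_neg (by omega)]; norm_num
  all_goals omega

theorem monic_f : (𝒞).f.Monic := by
  have h := natDegree_f l hl hl1 m hm
  rw [Monic, leadingCoeff, h]
  change (X ^ (2 * m) - C (1 + l ^ 2) * X ^ m + C (l ^ 2) : ℚ[X]).coeff (2 * m) = 1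
  have h1 : 2 * m ≠ m := by omega
  have h2 : m ≠ 0 := by omega
  rw [coeff_add, coeff_sub, coeff_C_mul, coeff_X_pow, coeff_X_pow, coeff_C]
  simp [h1, h2]

theorem fbar_eq : (𝒞).fbar = (X ^ m - 1) * (X ^ m - C (ℓ ^ 2)) := by
  change (X ^ (2 * m) - C (1 + l ^ 2) * X ^ m + C (l ^ 2) : ℚ[X]).map _ = _
  simp
  ring

theorem y_sq_eq : (𝒞).y ^ 2 = ((𝒞).x ^ m - 1) * ((𝒞).x ^ m - algebraMap 𝕂 _ ℓ ^ 2) := by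
  rw [y_sq, fbar_eq]
  simp

variable {l m}

/-! ### Points over `x = 0` -/

/-- `Q` is the point `(0, e)`. -/
structure IsZeroPoint (e : 𝕂) (Q : (𝒞).GeomPoint) : Prop where
  x_pos : 0 < Q.ord (𝒞).x
  y_pos : 0 < Q.ord ((𝒞).y - algebraMap 𝕂 _ e)

/-- Near `(0, e)`, where `e² = λ²`, the equation reads
`(y + e) (y - e) = x · x ^ (m - 1) (x ^ m - (1 + λ²))`. -/
theorem isLocalParameter_zero {e : 𝕂} (he : e ^ 2 = ℓ ^ 2) :
    IsLocalParameter (𝒞).x (𝒞).y 0 e ((𝒞).y + algebraMap 𝕂 _ e) (𝒞).x where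
  adjoin_eq_top := (𝒞).adjoin_x_y
  left := ⟨(𝒞).y + algebraMap 𝕂 _ e,
    add_mem (Algebra.subset_adjoin (by simp)) (Subalgebra.algebraMap_mem _ _), by
      rw [map_zero]; ring⟩
  right := by
    have hx : (𝒞).x ∈ Algebra.adjoin 𝕂 {(𝒞).x, (𝒞).y} := Algebra.subset_adjoin (by simp)
    refine ⟨(𝒞).x ^ (m - 1) * ((𝒞).x ^ m - algebraMap 𝕂 _ (1 + ℓ ^ 2)),
      mul_mem (pow_mem hx _) (sub_mem (pow_mem hx _) (Subalgebra.algebraMap_mem _ _)), ?_⟩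
    have h1 := y_sq_eq l hl hl1 m hm
    have h2 : (𝒞).x ^ m = (𝒞).x * (𝒞).x ^ (m - 1) := by
      rw [← pow_succ', Nat.sub_add_cancel hm.le]
    have h3 := congrArg (algebraMap 𝕂 (𝒞).FunctionField) he
    rw [map_pow, map_pow] at h3
    rw [map_add, map_one, map_pow]
    linear_combination h1 - h3 + ((𝒞).x ^ m - (1 + algebraMap 𝕂 _ ℓ ^ 2)) * h2

variable {hl hl1 hm}

theorem IsZeroPoint.ord_add {e : 𝕂} (he : e ≠ 0) {Q : (𝒞).GeomPoint}
    (h : IsZeroPoint hl hl1 hm e Q) : Q.ord ((𝒞).y + algebraMap 𝕂 _ e) = 0 := by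
  refine CurvePoint.ord_eq_zero_of_sub_pos (c := 2 * e) (by simpa using he) ?_
  convert h.y_pos using 2
  rw [map_mul, map_ofNat]
  ring

theorem IsZeroPoint.y_nonneg {e : 𝕂} {Q : (𝒞).GeomPoint}
    (h : IsZeroPoint hl hl1 hm e Q) : 0 ≤ Q.ord (𝒞).y := (𝒞).ord_y_nonneg h.x_pos.le

theorem IsZeroPoint.unique {e : 𝕂} (he : e ^ 2 = ℓ ^ 2) (he0 : e ≠ 0) {P Q : (𝒞).GeomPoint}
    (hP : IsZeroPoint hl hl1 hm e P) (hQ : IsZeroPoint hl hl1 hm e Q) : P = Q :=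
  (isLocalParameter_zero hl hl1 hm he).point_eq hP.x_pos.le hP.y_nonneg (hP.ord_add he0) hP.x_pos
    hQ.x_pos.le hQ.y_nonneg (hQ.ord_add he0) hQ.x_pos

theorem IsZeroPoint.ord_x {e : 𝕂} (he : e ^ 2 = ℓ ^ 2) (he0 : e ≠ 0) {P : (𝒞).GeomPoint}
    (hP : IsZeroPoint hl hl1 hm e P) : P.ord (𝒞).x = 1 :=
  (isLocalParameter_zero hl hl1 hm he).ord_eq_one hP.x_pos.le hP.y_nonneg (hP.ord_add he0) hP.x_pos

theorem exists_isZeroPoint {e : 𝕂} (he : e ^ 2 = ℓ ^ 2) (he0 : e ≠ 0) :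
    ∃ Q, IsZeroPoint hl hl1 hm e Q := by
  have h1 : m ≠ 0 := by omega
  obtain ⟨Q, hx, hy⟩ := (𝒞).exists_point_of_ne_zero (a := 0) he0 (by simp [fbar_eq, h1, he])
  exact ⟨Q, by simpa using hx, hy⟩

theorem isZeroPoint_of_pos {Q : (𝒞).GeomPoint} (hx : 0 < Q.ord (𝒞).x) :
    IsZeroPoint hl hl1 hm ℓ Q ∨ IsZeroPoint hl hl1 hm (-ℓ) Q := by
  obtain ⟨β, hβ, e⟩ := (isLocalParameter_zero hl hl1 hm (e := ℓ) rfl).right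
  have hβ' := CurvePoint.ord_nonneg_of_mem_adjoin hx.le ((𝒞).ord_y_nonneg hx.le) hβ
  have h := congrArg Q.ord e
  rw [AddValuation.map_mul, AddValuation.map_mul] at h
  have hpos : 0 < Q.ord ((𝒞).y + algebraMap 𝕂 _ ℓ) + Q.ord ((𝒞).y - algebraMap 𝕂 _ ℓ) :=
    h ▸ add_pos_of_pos_of_nonneg hx hβ'
  by_cases h1 : 0 < Q.ord ((𝒞).y - algebraMap 𝕂 _ ℓ)
  · exact Or.inl ⟨hx, h1⟩
  · refine Or.inr ⟨hx, ?_⟩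
    rw [map_neg, sub_neg_eq_add]
    by_contra h2
    exact absurd hpos (not_lt.mpr (add_nonpos (not_lt.mp h2) (not_lt.mp h1)))

/-! ### Points at infinity -/

/-- `Q` is the point at infinity at which `y / x ^ m` has value `e`. -/
structure IsInfinitePoint (e : 𝕂) (Q : (𝒞).GeomPoint) : Prop where
  x_pos : 0 < Q.ord (𝒞).x⁻¹
  y_pos : 0 < Q.ord ((𝒞).y * (𝒞).x⁻¹ ^ m - algebraMap 𝕂 _ e)

variable (hl hl1 hm) in
/-- With `t = 1 / x` and `w = y / x ^ m` the equation reads `w² = (1 - t ^ m) (1 - λ² t ^ m)`, so that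
`(w + e) (w - e)` is a multiple of `t` for `e² = 1`. -/
theorem isLocalParameter_infinity {e : 𝕂} (he : e ^ 2 = 1) :
    IsLocalParameter (𝒞).x⁻¹ ((𝒞).y * (𝒞).x⁻¹ ^ m) 0 e
      ((𝒞).y * (𝒞).x⁻¹ ^ m + algebraMap 𝕂 _ e) (𝒞).x⁻¹ where
  adjoin_eq_top := by
    have hx0 := (𝒞).x_ne_zero
    rw [eq_top_iff, ← (𝒞).adjoin_x_y, IntermediateField.adjoin_le_iff]
    have h1 : (𝒞).x⁻¹ ∈ IntermediateField.adjoin 𝕂 {(𝒞).x⁻¹, (𝒞).y * (𝒞).x⁻¹ ^ m} :=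
      IntermediateField.subset_adjoin _ _ (by simp)
    have h2 : (𝒞).y * (𝒞).x⁻¹ ^ m ∈ IntermediateField.adjoin 𝕂 {(𝒞).x⁻¹, (𝒞).y * (𝒞).x⁻¹ ^ m} :=
      IntermediateField.subset_adjoin _ _ (by simp)
    have h3 : (𝒞).x ∈ IntermediateField.adjoin 𝕂 {(𝒞).x⁻¹, (𝒞).y * (𝒞).x⁻¹ ^ m} :=
      inv_mem_iff.mp h1
    have h4 := mul_mem h2 (pow_mem h3 m)
    rw [mul_assoc, ← mul_pow, inv_mul_cancel₀ hx0, one_pow, mul_one] at h4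
    rintro z (rfl | rfl)
    exacts [h3, h4]
  left := ⟨(𝒞).y * (𝒞).x⁻¹ ^ m + algebraMap 𝕂 _ e,
    add_mem (Algebra.subset_adjoin (by simp)) (Subalgebra.algebraMap_mem _ _), by
      rw [map_zero]; ring⟩
  right := by
    have hx : (𝒞).x⁻¹ ∈ Algebra.adjoin 𝕂 {(𝒞).x⁻¹, (𝒞).y * (𝒞).x⁻¹ ^ m} :=
      Algebra.subset_adjoin (by simp)
    refine ⟨(𝒞).x⁻¹ ^ (m - 1) * (algebraMap 𝕂 _ (ℓ ^ 2) * (𝒞).x⁻¹ ^ m -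
        algebraMap 𝕂 _ (1 + ℓ ^ 2)),
      mul_mem (pow_mem hx _) (sub_mem (mul_mem (Subalgebra.algebraMap_mem _ _) (pow_mem hx _))
        (Subalgebra.algebraMap_mem _ _)), ?_⟩
    have h1 := y_sq_eq l hl hl1 m hm
    have h2 : (𝒞).x⁻¹ ^ m = (𝒞).x⁻¹ * (𝒞).x⁻¹ ^ (m - 1) := by
      rw [← pow_succ', Nat.sub_add_cancel hm.le]
    have h3 := congrArg (algebraMap 𝕂 (𝒞).FunctionField) he
    have h4 : (𝒞).x ^ m * (𝒞).x⁻¹ ^ m = 1 := by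
      rw [← mul_pow, mul_inv_cancel₀ (𝒞).x_ne_zero, one_pow]
    rw [map_pow, map_one] at h3
    rw [map_add, map_one, map_pow]
    linear_combination (𝒞).x⁻¹ ^ m * (𝒞).x⁻¹ ^ m * h1 - h3 +
      (algebraMap 𝕂 _ ℓ ^ 2 * (𝒞).x⁻¹ ^ m - (1 + algebraMap 𝕂 _ ℓ ^ 2)) * h2
      + ((𝒞).x ^ m * (𝒞).x⁻¹ ^ m + 1 - (1 + algebraMap 𝕂 _ ℓ ^ 2) * (𝒞).x⁻¹ ^ m) * h4

theorem IsInfinitePoint.ord_add {e : 𝕂} (he : e ^ 2 = 1) {Q : (𝒞).GeomPoint}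
    (h : IsInfinitePoint e Q) : Q.ord ((𝒞).y * (𝒞).x⁻¹ ^ m + algebraMap 𝕂 _ e) = 0 := by
  have he0 : e ≠ 0 := by rintro rfl; simp at he
  refine CurvePoint.ord_eq_zero_of_sub_pos (c := 2 * e) (by simpa using he0) ?_
  convert h.y_pos using 2
  rw [map_mul, map_ofNat]
  ring

theorem IsInfinitePoint.y_nonneg {e : 𝕂} {Q : (𝒞).GeomPoint}
    (h : IsInfinitePoint e Q) : 0 ≤ Q.ord ((𝒞).y * (𝒞).x⁻¹ ^ m) :=
  CurvePoint.ord_nonneg_of_sub_pos h.y_pos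

theorem IsInfinitePoint.unique {e : 𝕂} (he : e ^ 2 = 1) {P Q : (𝒞).GeomPoint}
    (hP : IsInfinitePoint e P) (hQ : IsInfinitePoint e Q) : P = Q :=
  (isLocalParameter_infinity hl hl1 hm he).point_eq hP.x_pos.le hP.y_nonneg (hP.ord_add he)
    hP.x_pos hQ.x_pos.le hQ.y_nonneg (hQ.ord_add he) hQ.x_pos

theorem IsInfinitePoint.ord_inv_x {e : 𝕂} (he : e ^ 2 = 1) {P : (𝒞).GeomPoint}
    (hP : IsInfinitePoint e P) : P.ord (𝒞).x⁻¹ = 1 :=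
  (isLocalParameter_infinity hl hl1 hm he).ord_eq_one hP.x_pos.le hP.y_nonneg (hP.ord_add he)
    hP.x_pos

theorem IsInfinitePoint.involution {e : 𝕂} {P : (𝒞).GeomPoint} (hP : IsInfinitePoint e P) :
    IsInfinitePoint (-e) ((𝒞).involution.pointMap P) where
  x_pos := by
    rw [← ord_involution, map_inv₀, involution_x]
    exact hP.x_pos
  y_pos := by
    rw [← ord_involution, map_sub, map_mul, map_pow, map_inv₀, involution_x, involution_y,
      involution_algebraMap, ← AddValuation.map_neg]
    convert hP.y_pos using 2
    rw [map_neg]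
    ring

theorem IsZeroPoint.involution {e : 𝕂} {P : (𝒞).GeomPoint} (hP : IsZeroPoint hl hl1 hm e P) :
    IsZeroPoint hl hl1 hm (-e) ((𝒞).involution.pointMap P) where
  x_pos := by
    rw [← ord_involution, involution_x]
    exact hP.x_pos
  y_pos := by
    rw [← ord_involution, map_sub, involution_y, involution_algebraMap, ← AddValuation.map_neg]
    convert hP.y_pos using 2
    rw [map_neg]
    ring

theorem exists_isInfinitePoint : ∃ Q : (𝒞).GeomPoint, IsInfinitePoint 1 Q := by
  obtain ⟨Q, hx, hy⟩ := (𝒞).exists_point_infinity (natDegree_f l hl hl1 m hm)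
    (monic_f l hl hl1 m hm)
  exact ⟨Q, by rw [hx]; exact zero_lt_one, by rwa [map_one]⟩

theorem isInfinitePoint_of_neg {Q : (𝒞).GeomPoint} (hx : Q.ord (𝒞).x < 0) :
    IsInfinitePoint 1 Q ∨ IsInfinitePoint (-1) Q := by
  have hx' : 0 < Q.ord (𝒞).x⁻¹ := by
    by_contra h
    have e := congrArg Q.ord (mul_inv_cancel₀ (𝒞).x_ne_zero)
    rw [AddValuation.map_mul, AddValuation.map_one] at e
    exact absurd e ((add_le_of_nonpos_right (not_lt.mp h)).trans_lt hx).ne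
  obtain ⟨β, hβ, e⟩ := (isLocalParameter_infinity hl hl1 hm (e := 1) (one_pow 2)).right
  have hw : 0 ≤ Q.ord ((𝒞).y * (𝒞).x⁻¹ ^ m) := by
    have h1 : ((𝒞).y * (𝒞).x⁻¹ ^ m) ^ 2 = aeval (𝒞).x⁻¹ ((1 - X ^ m) * (1 - C (ℓ ^ 2) * X ^ m)) := by
      have h4 : (𝒞).x ^ m * (𝒞).x⁻¹ ^ m = 1 := by
        rw [← mul_pow, mul_inv_cancel₀ (𝒞).x_ne_zero, one_pow]
      rw [mul_pow, y_sq_eq]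
      simp only [map_mul, map_sub, map_one, map_pow, aeval_X, aeval_C]
      linear_combination ((𝒞).x ^ m * (𝒞).x⁻¹ ^ m + 1 -
        (1 + algebraMap 𝕂 _ ℓ ^ 2) * (𝒞).x⁻¹ ^ m) * h4
    have h := CurvePoint.ord_aeval_nonneg hx'.le ((1 - X ^ m) * (1 - C (ℓ ^ 2) * X ^ m))
    rw [← h1] at h
    exact CurvePoint.ord_nonneg_of_sq h
  have hβ' := CurvePoint.ord_nonneg_of_mem_adjoin hx'.le hw hβ
  have h := congrArg Q.ord e
  rw [AddValuation.map_mul, AddValuation.map_mul] at h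
  have hpos : 0 < Q.ord ((𝒞).y * (𝒞).x⁻¹ ^ m + algebraMap 𝕂 _ 1) +
      Q.ord ((𝒞).y * (𝒞).x⁻¹ ^ m - algebraMap 𝕂 _ 1) :=
    h ▸ add_pos_of_pos_of_nonneg hx' hβ'
  by_cases h1 : 0 < Q.ord ((𝒞).y * (𝒞).x⁻¹ ^ m - algebraMap 𝕂 _ 1)
  · exact Or.inl ⟨hx', h1⟩
  · refine Or.inr ⟨hx', ?_⟩
    rw [map_neg, sub_neg_eq_add]
    by_contra h2
    exact absurd hpos (not_lt.mpr (add_nonpos (not_lt.mp h2) (not_lt.mp h1)))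

/-! ### Rational points -/

theorem IsZeroPoint.isRationalPoint {e : ℚ} (he : e ^ 2 = l ^ 2) (he0 : e ≠ 0) {P : (𝒞).GeomPoint}
    (hP : IsZeroPoint hl hl1 hm (e : 𝕂) P) : (𝒞).IsRationalPoint P := by
  intro σ
  refine IsZeroPoint.unique (by exact_mod_cast he) (by exact_mod_cast he0) ⟨?_, ?_⟩ hP
  · rw [ord_galAut _ _ _ ((𝒞).galAut_x σ)]
    exact hP.x_pos
  · rw [ord_galAut _ _ _ (by rw [map_sub, galAut_y, galAut_ratCast])]
    exact hP.y_pos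

theorem IsInfinitePoint.isRationalPoint {e : ℚ} (he : e ^ 2 = 1) {P : (𝒞).GeomPoint}
    (hP : IsInfinitePoint (e : 𝕂) P) : (𝒞).IsRationalPoint P := by
  intro σ
  refine IsInfinitePoint.unique (by exact_mod_cast he) ⟨?_, ?_⟩ hP
  · rw [ord_galAut _ _ _ (by rw [map_inv₀, galAut_x])]
    exact hP.x_pos
  · rw [ord_galAut _ _ _ (by rw [map_sub, map_mul, map_pow, map_inv₀, galAut_y, galAut_x,
      galAut_ratCast])]
    exact hP.y_pos

/-- The point `(1, 0)` is a rational Weierstrass point. -/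
theorem exists_rational_weierstrassPoint :
    ∃ P : (𝒞).GeomPoint, (𝒞).IsRationalPoint P ∧ (𝒞).IsWeierstrassPoint P := by
  -- `y² = (x - 1) S(x)` with `S(1) ≠ 0`, so `y` is a local parameter at `(1, 0)`.
  set S : 𝕂[X] := (∑ i ∈ Finset.range m, X ^ i) * (X ^ m - C (ℓ ^ 2)) with hS
  have hS1 : S.eval 1 ≠ 0 := by
    have h1 : m ≠ 0 := by omega
    have h2 : 1 - ℓ ^ 2 ≠ 0 := by
      rw [sub_ne_zero]
      exact_mod_cast hl1.symm
    simp only [hS, eval_mul, eval_finsetSum, eval_pow, eval_X, one_pow, Finset.sum_const,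
      Finset.card_range, nsmul_eq_mul, mul_one, eval_sub, eval_C]
    exact mul_ne_zero (by exact_mod_cast h1) h2
  have hxS : aeval (𝒞).x S * ((𝒞).x - algebraMap 𝕂 _ 1) = (𝒞).y * (𝒞).y := by
    have h := geom_sum_mul (𝒞).x m
    rw [← sq, y_sq_eq, hS]
    simp only [map_mul, map_sum, map_pow, map_sub, aeval_X, aeval_C, map_one]
    linear_combination ((𝒞).x ^ m - algebraMap 𝕂 _ ℓ ^ 2) * h
  have H : IsLocalParameter (K := 𝕂) (𝒞).x (𝒞).y 1 0 (aeval (𝒞).x S) (𝒞).y := by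
    refine ⟨(𝒞).adjoin_x_y, ⟨(𝒞).y, Algebra.subset_adjoin (by simp), hxS⟩, aeval (𝒞).x S, ?_, ?_⟩
    · exact Algebra.adjoin_mono (by simp) (aeval_mem_adjoin_singleton _ _)
    · rw [map_zero]; ring
  have huniq {P Q : (𝒞).GeomPoint} (hP : 0 < P.ord ((𝒞).x - algebraMap 𝕂 _ 1))
      (hP' : 0 < P.ord (𝒞).y) (hQ : 0 < Q.ord ((𝒞).x - algebraMap 𝕂 _ 1))
      (hQ' : 0 < Q.ord (𝒞).y) : P = Q :=
    H.point_eq (CurvePoint.ord_nonneg_of_sub_pos hP) hP'.le (CurvePoint.ord_aeval_eq_zero hP hS1)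
      hP' (CurvePoint.ord_nonneg_of_sub_pos hQ) hQ'.le (CurvePoint.ord_aeval_eq_zero hQ hS1) hQ'
  obtain ⟨P, hx, hy⟩ := (𝒞).exists_point_of_root (a := 1) (by simp [fbar_eq])
  have hx' : 0 < P.ord ((𝒞).x - algebraMap 𝕂 _ 1) := by rw [hx]; exact zero_lt_two
  have hy' : 0 < P.ord (𝒞).y := by rw [hy]; exact zero_lt_one
  refine ⟨P, fun σ => huniq ?_ ?_ hx' hy', huniq ?_ ?_ hx' hy'⟩
  · rwa [ord_galAut _ _ _ (by
      rw [← Rat.cast_one, map_sub, galAut_x, galAut_ratCast])]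
  · rwa [ord_galAut _ _ _ ((𝒞).galAut_y σ)]
  · rwa [← ord_involution, map_sub, involution_x, involution_algebraMap]
  · rwa [← ord_involution, involution_y, AddValuation.map_neg]

/-! ### Two functions with divisors divisible by `m` -/

variable (hl hl1 hm) in
/-- The function `α y + β x ^ m + γ`. -/
def linFun (α β γ : 𝕂) : (𝒞).FunctionField :=
  algebraMap 𝕂 _ α * (𝒞).y + algebraMap 𝕂 _ β * (𝒞).x ^ m + algebraMap 𝕂 _ γ

theorem linFun_nonneg {Q : (𝒞).GeomPoint} (hx : 0 ≤ Q.ord (𝒞).x) (α β γ : 𝕂) :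
    0 ≤ Q.ord (linFun hl hl1 hm α β γ) := by
  have h1 : (𝒞).x ∈ Q.integers := hx
  have h2 : (𝒞).y ∈ Q.integers := (𝒞).ord_y_nonneg hx
  exact add_mem (add_mem (mul_mem (Q.integers.algebraMap_mem α) h2)
    (mul_mem (Q.integers.algebraMap_mem β) (pow_mem h1 m))) (Q.integers.algebraMap_mem γ)

/-- The value of `α y + β x ^ m + γ` at `(0, e)` is `α e + γ`. -/
theorem IsZeroPoint.linFun_eq_zero {e : 𝕂} {Q : (𝒞).GeomPoint} (hQ : IsZeroPoint hl hl1 hm e Q)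
    {α β γ : 𝕂} (h : α * e + γ ≠ 0) : Q.ord (linFun hl hl1 hm α β γ) = 0 := by
  refine CurvePoint.ord_eq_zero_of_sub_pos h ?_
  have e1 : linFun hl hl1 hm α β γ - algebraMap 𝕂 _ (α * e + γ) =
      algebraMap 𝕂 _ α * ((𝒞).y - algebraMap 𝕂 _ e) +
        algebraMap 𝕂 _ β * (𝒞).x ^ (m - 1) * (𝒞).x := by
    rw [mul_assoc, ← pow_succ, Nat.sub_add_cancel hm.le, map_add, map_mul, linFun]
    ring
  have h1 : (𝒞).x ∈ Q.integers := hQ.x_pos.le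
  rw [e1]
  refine Q.ord.map_lt_add ?_ ?_
  · rw [AddValuation.map_mul]
    exact hQ.y_pos.trans_le (le_add_of_nonneg_left (Q.ord_algebraMap_nonneg α))
  · rw [AddValuation.map_mul]
    exact hQ.x_pos.trans_le (le_add_of_nonneg_left
      (mul_mem (Q.integers.algebraMap_mem β) (pow_mem h1 (m - 1))))

theorem IsInfinitePoint.ord_x {e : 𝕂} (he : e ^ 2 = 1) {Q : (𝒞).GeomPoint}
    (hQ : IsInfinitePoint e Q) : Q.ord (𝒞).x = ((-1 : ℤ) : WithTop ℤ) :=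
  CurvePoint.ord_eq_neg_one_of_inv (hQ.ord_inv_x he)

theorem IsInfinitePoint.ord_x_pow {e : 𝕂} (he : e ^ 2 = 1) {Q : (𝒞).GeomPoint}
    (hQ : IsInfinitePoint e Q) : Q.ord ((𝒞).x ^ m) = ((-m : ℤ) : WithTop ℤ) := by
  rw [AddValuation.map_pow, hQ.ord_x he]
  norm_cast
  simp

/-- The function `(α y + β x ^ m + γ) / x ^ m` has value `α e + β` at the point at infinity with
`y / x ^ m = e`. -/
theorem IsInfinitePoint.linFun_eq {e : 𝕂} (he : e ^ 2 = 1) {Q : (𝒞).GeomPoint}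
    (hQ : IsInfinitePoint e Q) {α β γ : 𝕂} (h : α * e + β ≠ 0) :
    Q.ord (linFun hl hl1 hm α β γ) = ((-m : ℤ) : WithTop ℤ) := by
  have h4 : (𝒞).x ^ m * (𝒞).x⁻¹ ^ m = 1 := by
    rw [← mul_pow, mul_inv_cancel₀ (𝒞).x_ne_zero, one_pow]
  have h5 : (𝒞).x⁻¹ ^ m = (𝒞).x⁻¹ ^ (m - 1) * (𝒞).x⁻¹ := by
    rw [← pow_succ, Nat.sub_add_cancel hm.le]
  have e1 : linFun hl hl1 hm α β γ = (𝒞).x ^ m * (algebraMap 𝕂 _ α * ((𝒞).y * (𝒞).x⁻¹ ^ m) +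
      algebraMap 𝕂 _ β + algebraMap 𝕂 _ γ * (𝒞).x⁻¹ ^ m) := by
    rw [linFun]
    linear_combination (-(algebraMap 𝕂 _ α * (𝒞).y) - algebraMap 𝕂 _ γ) * h4
  rw [e1, AddValuation.map_mul, hQ.ord_x_pow he]
  suffices Q.ord (algebraMap 𝕂 _ α * ((𝒞).y * (𝒞).x⁻¹ ^ m) +
      algebraMap 𝕂 _ β + algebraMap 𝕂 _ γ * (𝒞).x⁻¹ ^ m) = 0 by rw [this, add_zero]
  refine CurvePoint.ord_eq_zero_of_sub_pos h ?_
  have e2 : algebraMap 𝕂 _ α * ((𝒞).y * (𝒞).x⁻¹ ^ m) +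
      algebraMap 𝕂 _ β + algebraMap 𝕂 _ γ * (𝒞).x⁻¹ ^ m - algebraMap 𝕂 _ (α * e + β) =
      algebraMap 𝕂 _ α * ((𝒞).y * (𝒞).x⁻¹ ^ m - algebraMap 𝕂 _ e) +
        algebraMap 𝕂 _ γ * (𝒞).x⁻¹ ^ (m - 1) * (𝒞).x⁻¹ := by
    rw [map_add, map_mul]
    linear_combination algebraMap 𝕂 _ γ * h5
  have h1 : (𝒞).x⁻¹ ∈ Q.integers := hQ.x_pos.le
  rw [e2]
  refine Q.ord.map_lt_add ?_ ?_
  · rw [AddValuation.map_mul]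
    exact hQ.y_pos.trans_le (le_add_of_nonneg_left (Q.ord_algebraMap_nonneg α))
  · rw [AddValuation.map_mul]
    exact hQ.x_pos.trans_le (le_add_of_nonneg_left
      (mul_mem (Q.integers.algebraMap_mem γ) (pow_mem h1 (m - 1))))

theorem ell_ne_zero (hl : l ≠ 0) : ℓ ≠ 0 := by exact_mod_cast hl

theorem ell_sq_ne_one (hl1 : l ^ 2 ≠ 1) : ℓ ^ 2 ≠ 1 := by exact_mod_cast hl1

/-- `f` is the square of `x ^ m - (1 + λ²) / 2` up to a constant. -/
theorem linFun_mul_const : linFun hl hl1 hm 2 (-2) (1 + ℓ ^ 2) *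
    linFun hl hl1 hm 2 2 (-(1 + ℓ ^ 2)) = algebraMap 𝕂 _ (-(1 - ℓ ^ 2) ^ 2) := by
  have h := y_sq_eq l hl hl1 m hm
  simp only [linFun, map_neg, map_add, map_one, map_pow, map_sub, map_ofNat]
  linear_combination 4 * h

/-- `f = (x ^ m + λ)² - (1 + λ)² x ^ m`. -/
theorem linFun_mul_x_pow : linFun hl hl1 hm 1 (-1) (-ℓ) * linFun hl hl1 hm 1 1 ℓ =
    algebraMap 𝕂 _ (-(1 + ℓ) ^ 2) * (𝒞).x ^ m := by
  have h := y_sq_eq l hl hl1 m hm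
  simp only [linFun, map_neg, map_add, map_one, map_pow]
  linear_combination h

theorem ord_linFun_mul_const (Q : (𝒞).GeomPoint) : Q.ord (linFun hl hl1 hm 2 (-2) (1 + ℓ ^ 2) *
    linFun hl hl1 hm 2 2 (-(1 + ℓ ^ 2))) = 0 := by
  rw [linFun_mul_const]
  exact Q.ord_const _ (neg_ne_zero.mpr (pow_ne_zero _ (sub_ne_zero.mpr (ell_sq_ne_one hl1).symm)))

theorem ord_linFun_mul_x_pow (Q : (𝒞).GeomPoint) : Q.ord (linFun hl hl1 hm 1 (-1) (-ℓ) *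
    linFun hl hl1 hm 1 1 ℓ) = Q.ord ((𝒞).x ^ m) := by
  have h : 1 + ℓ ≠ 0 := fun h => ell_sq_ne_one hl1 (by
    rw [eq_neg_of_add_eq_zero_right h]; norm_num)
  rw [linFun_mul_x_pow, AddValuation.map_mul,
    Q.ord_const _ (neg_ne_zero.mpr (pow_ne_zero _ h)), zero_add]

theorem infinitePoint_ne {P₁ P₂ : (𝒞).GeomPoint} (h₁ : IsInfinitePoint 1 P₁) (h₂ : IsInfinitePoint (-1) P₂) : P₁ ≠ P₂ := by
  rintro rfl
  have h := h₁.ord_add (one_pow 2)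
  have h' := h₂.y_pos
  rw [map_neg, sub_neg_eq_add, h] at h'
  exact lt_irrefl _ h'

theorem infinitePoint_ne_of_nonneg {P₁ Z : (𝒞).GeomPoint} {e : 𝕂} (he : e ^ 2 = 1) (h₁ : IsInfinitePoint e P₁)
    (hx : 0 ≤ Z.ord (𝒞).x) : Z ≠ P₁ := by
  rintro rfl
  rw [h₁.ord_x he] at hx
  exact absurd hx (by decide)

theorem zeroPoint_ne {P₁ P₂ : (𝒞).GeomPoint} (h₁ : IsZeroPoint hl hl1 hm ℓ P₁) (h₂ : IsZeroPoint hl hl1 hm (-ℓ) P₂) :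
    P₁ ≠ P₂ := by
  rintro rfl
  have h := h₁.ord_add (ell_ne_zero hl)
  have h' := h₂.y_pos
  rw [map_neg, sub_neg_eq_add, h] at h'
  exact lt_irrefl _ h'

/-- `div (2y - 2x ^ m + 1 + λ²) = m (∞₊ - ∞₋)`. -/
theorem ord_linFun_infinity {P₁ P₂ : (𝒞).GeomPoint} (h₁ : IsInfinitePoint 1 P₁) (h₂ : IsInfinitePoint (-1) P₂)
    (Q : (𝒞).GeomPoint) : Q.ord (linFun hl hl1 hm 2 (-2) (1 + ℓ ^ 2)) =
      (((m • (Finsupp.single P₁ 1 - Finsupp.single P₂ 1) : CurveDivisor _ _) Q : ℤ) :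
        WithTop ℤ) := by
  have hne := infinitePoint_ne h₁ h₂
  have hm1 : ((-1 : 𝕂)) ^ 2 = 1 := by norm_num
  rcases le_or_gt 0 (Q.ord (𝒞).x) with hx | hx
  · have hQ1 := infinitePoint_ne_of_nonneg (one_pow 2) h₁ hx
    have hQ2 := infinitePoint_ne_of_nonneg hm1 h₂ hx
    rw [CurvePoint.ord_eq_zero_of_mul (linFun_nonneg hx _ _ _) (linFun_nonneg hx 2 2 (-(1 + ℓ ^ 2)))
      (ord_linFun_mul_const Q)]
    simp [hQ1.symm, hQ2.symm]
  · rcases isInfinitePoint_of_neg hx with hQ | hQ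
    · obtain rfl := h₁.unique (one_pow 2) hQ
      rw [CurvePoint.ord_eq_sub_of_mul (ord_linFun_mul_const P₁) (h₁.linFun_eq (one_pow 2) (by norm_num))]
      simp [hne.symm]
    · obtain rfl := h₂.unique hm1 hQ
      rw [h₂.linFun_eq hm1 (by norm_num)]
      simp [hne]

/-- `div (y - x ^ m - λ) = m ((0, λ) - ∞₋)`. -/
theorem ord_linFun_zero {P₁ P₂ Z : (𝒞).GeomPoint} (h₁ : IsInfinitePoint 1 P₁) (h₂ : IsInfinitePoint (-1) P₂)
    (hZ : IsZeroPoint hl hl1 hm ℓ Z) (Q : (𝒞).GeomPoint) :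
    Q.ord (linFun hl hl1 hm 1 (-1) (-ℓ)) =
      (((m • (Finsupp.single Z 1 - Finsupp.single P₂ 1) : CurveDivisor _ _) Q : ℤ) :
        WithTop ℤ) := by
  have hne := infinitePoint_ne h₁ h₂
  have hm1 : ((-1 : 𝕂)) ^ 2 = 1 := by norm_num
  have hl0 := ell_ne_zero hl
  have hZ1 := infinitePoint_ne_of_nonneg (one_pow 2) h₁ hZ.x_pos.le
  have hZ2 := infinitePoint_ne_of_nonneg hm1 h₂ hZ.x_pos.le
  rcases lt_trichotomy (Q.ord (𝒞).x) 0 with hx | hx | hx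
  · rcases isInfinitePoint_of_neg hx with hQ | hQ
    · obtain rfl := h₁.unique (one_pow 2) hQ
      rw [CurvePoint.ord_eq_sub_of_mul ((ord_linFun_mul_x_pow P₁).trans (h₁.ord_x_pow (one_pow 2)))
        (h₁.linFun_eq (one_pow 2) (by norm_num))]
      simp [hne.symm, hZ1]
    · obtain rfl := h₂.unique hm1 hQ
      rw [h₂.linFun_eq hm1 (by norm_num)]
      simp [hZ2]
  · have hQ2 := infinitePoint_ne_of_nonneg hm1 h₂ hx.ge
    have hQZ : Q ≠ Z := by rintro rfl; exact hZ.x_pos.ne' hx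
    rw [CurvePoint.ord_eq_zero_of_mul (linFun_nonneg hx.ge _ _ _) (linFun_nonneg hx.ge 1 1 ℓ)
      (by rw [ord_linFun_mul_x_pow, AddValuation.map_pow, hx, smul_zero])]
    simp [hQ2.symm, hQZ.symm]
  · rcases isZeroPoint_of_pos hx with hQ | hQ
    · obtain rfl := hZ.unique rfl hl0 hQ
      have e1 : Z.ord ((𝒞).x ^ m) = ((m : ℤ) : WithTop ℤ) := by
        rw [AddValuation.map_pow, hZ.ord_x rfl hl0, nsmul_one]
        norm_cast
      rw [CurvePoint.ord_eq_sub_of_mul (j := 0) ((ord_linFun_mul_x_pow Z).trans e1)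
        (hZ.linFun_eq_zero (by rw [one_mul, ← two_mul]; exact mul_ne_zero two_ne_zero hl0))]
      simp [hZ2.symm]
    · have hQ2 := infinitePoint_ne_of_nonneg hm1 h₂ hx.le
      have hQZ := zeroPoint_ne hZ hQ
      rw [hQ.linFun_eq_zero (by
        rw [one_mul, ← two_mul]; exact mul_ne_zero two_ne_zero (neg_ne_zero.mpr hl0))]
      simp [hQ2.symm, hQZ]

/-! ### Independence -/

/-- A function with divisor `a ∞₊ + b (0, λ) - (a + b) ∞₋` and poles of order less than `m` is a
function of `x`, so its divisor is invariant under the hyperelliptic involution. -/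
theorem eq_zero_of_small_poles {P₁ P₂ Z : (𝒞).GeomPoint} (h₁ : IsInfinitePoint 1 P₁) (h₂ : IsInfinitePoint (-1) P₂)
    (hZ : IsZeroPoint hl hl1 hm ℓ Z) {a b : ℤ} (ha : -m < a) (hb : 0 ≤ b) (hab : a + b < m)
    {g : (𝒞).FunctionField}
    (hg : ∀ Q : (𝒞).GeomPoint, Q.ord g =
      (((a • (Finsupp.single P₁ 1 - Finsupp.single P₂ 1) +
        b • (Finsupp.single Z 1 - Finsupp.single P₂ 1) : CurveDivisor _ _) Q : ℤ) : WithTop ℤ)) :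
    a = 0 ∧ b = 0 := by
  have hne := infinitePoint_ne h₁ h₂
  have hm1 : ((-1 : 𝕂)) ^ 2 = 1 := by norm_num
  have hZ1 := infinitePoint_ne_of_nonneg (one_pow 2) h₁ hZ.x_pos.le
  have hZ2 := infinitePoint_ne_of_nonneg hm1 h₂ hZ.x_pos.le
  have hg1 : P₁.ord g = (a : WithTop ℤ) := by
    rw [hg]; simp [hne.symm, hZ1]
  have hg2 : P₂.ord g = ((-a - b : ℤ) : WithTop ℤ) := by
    rw [hg]; simp [hne, hZ2]; rfl
  have hgZ : Z.ord g = (b : WithTop ℤ) := by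
    rw [hg]; simp [hZ1.symm, hZ2.symm]
  have hι : (𝒞).involution.toRingEquiv g = g := by
    refine (𝒞).involution_eq_self_of_small_poles (natDegree_f l hl hl1 m hm)
      (monic_f l hl hl1 m hm) (fun Q hx => ?_) (fun Q hx => ?_)
    · by_cases hQ : Q = Z
      · rw [hQ, hgZ]
        exact_mod_cast hb
      · have hQ1 := infinitePoint_ne_of_nonneg (one_pow 2) h₁ hx
        have hQ2 := infinitePoint_ne_of_nonneg hm1 h₂ hx
        rw [hg]
        simp [hQ1.symm, hQ2.symm, Ne.symm hQ]
    · rcases isInfinitePoint_of_neg hx with hQ | hQ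
      · rw [hQ.unique (one_pow 2) h₁, hg1]
        exact_mod_cast ha
      · rw [hQ.unique hm1 h₂, hg2]
        exact_mod_cast (by omega : -(m : ℤ) < -a - b)
  have hb0 : b = 0 := by
    -- The coefficients of the divisor at `(0, λ)` and `(0, -λ)` are `b` and `0`.
    have h := ord_involution _ Z g
    rw [hι, hgZ, hg] at h
    have hZ' := hZ.involution
    have hne' := zeroPoint_ne hZ hZ'
    have h1' := infinitePoint_ne_of_nonneg (one_pow 2) h₁ hZ'.x_pos.le
    have h2' := infinitePoint_ne_of_nonneg hm1 h₂ hZ'.x_pos.le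
    simpa [hne', h1'.symm, h2'.symm] using h
  refine ⟨?_, hb0⟩
  -- The coefficients at the two points at infinity are `a` and `-a - b`.
  have h := ord_involution _ P₁ g
  rw [hι, hg1, h₁.involution.unique hm1 h₂, hg2] at h
  have h' : a = -a - b := by exact_mod_cast h
  omega

/-- A relation with coefficients less than `m` is trivial: when `a + b ≥ m`, subtracting
`m (∞₊ - ∞₋)` makes all pole orders less than `m`. -/
theorem eq_zero_of_mem_principal {P₁ P₂ Z : (𝒞).GeomPoint} (h₁ : IsInfinitePoint 1 P₁) (h₂ : IsInfinitePoint (-1) P₂)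
    (hZ : IsZeroPoint hl hl1 hm ℓ Z) {a b : ℕ} (ha : a < m) (hb : b < m)
    (h : a • (Finsupp.single P₁ 1 - Finsupp.single P₂ 1) +
      b • (Finsupp.single Z 1 - Finsupp.single P₂ 1) ∈
        CurveDivisor.principal 𝕂 (𝒞).FunctionField) : a = 0 ∧ b = 0 := by
  rcases lt_or_ge (a + b) m with hab | hab
  · obtain ⟨g, -, hg⟩ := h
    have := eq_zero_of_small_poles h₁ h₂ hZ (a := a) (b := b) (by omega) (by omega)
      (by exact_mod_cast hab) (g := g) (fun Q => by rw [hg Q, natCast_zsmul, natCast_zsmul])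
    omega
  · have h' := sub_mem h (show m • (Finsupp.single P₁ 1 - Finsupp.single P₂ 1) ∈
        CurveDivisor.principal 𝕂 (𝒞).FunctionField from
      ⟨_, fun h0 => by
        have := ord_linFun_infinity h₁ h₂ P₁
        rw [h0, AddValuation.map_zero] at this
        exact WithTop.top_ne_coe this, ord_linFun_infinity h₁ h₂⟩)
    obtain ⟨g, -, hg⟩ := h'
    have := eq_zero_of_small_poles h₁ h₂ hZ (a := a - m) (b := b) (by omega) (by omega)
      (by omega) (g := g) (fun Q => by
        rw [hg Q, sub_zsmul, natCast_zsmul, natCast_zsmul, natCast_zsmul]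
        congr 2
        abel)
    omega

end yamamotoCurve

/-! ### Torsion of the Jacobian -/

/-- Two elements of order dividing `m` without nontrivial relations modulo `m` span a copy of
`(ℤ/mℤ)²`. -/
theorem two_le_mRank {A : Type*} [AddCommGroup A] {m : ℕ} (hm : 0 < m) {c d : A} (hc : m • c = 0)
    (hd : m • d = 0) (h : ∀ a b : ℕ, a < m → b < m → a • c + b • d = 0 → a = 0 ∧ b = 0) :
    2 ≤ mRank m A := by
  have : NeZero m := ⟨hm.ne'⟩
  let f (c : A) (hc : m • c = 0) : ZMod m →+ A :=
    ZMod.lift m ⟨zmultiplesHom A c, by simpa using hc⟩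
  have hf (c : A) (hc : m • c = 0) (z : ZMod m) : f c hc z = z.val • c := by
    conv_lhs => rw [← ZMod.natCast_zmod_val z]
    have := ZMod.lift_coe m ⟨zmultiplesHom A c, by simpa using hc⟩ (z.val : ℤ)
    rw [Int.cast_natCast] at this
    exact this.trans (natCast_zsmul c z.val)
  refine le_iSup₂_of_le (f := fun (r : ℕ) _ => (r : ℕ∞)) 2
    ⟨(f c hc).comp (Pi.evalAddMonoidHom _ 0) + (f d hd).comp (Pi.evalAddMonoidHom _ 1), ?_⟩ le_rfl
  rw [injective_iff_map_eq_zero]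
  intro v hv
  simp only [AddMonoidHom.add_apply, AddMonoidHom.comp_apply, Pi.evalAddMonoidHom_apply, hf] at hv
  obtain ⟨h0, h1⟩ := h _ _ (ZMod.val_lt _) (ZMod.val_lt _) hv
  ext i
  fin_cases i
  · simpa using h0
  · simpa using h1

namespace HyperellipticCurve

variable {k : Type*} [Field k] [CharZero k] (C : HyperellipticCurve k)

/-- The divisor `P - Q` of degree zero. -/
def subDivisor (P Q : C.GeomPoint) : CurveDivisor.degZero (AlgebraicClosure k) C.FunctionField :=
  ⟨Finsupp.single P 1 - Finsupp.single Q 1, by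
    change CurveDivisor.deg _ _ _ = 0
    rw [map_sub]
    simp [CurveDivisor.deg]⟩

/-- The class of the divisor `P - Q` in the Jacobian. -/
def subClass (P Q : C.GeomPoint) : C.JacGeom := QuotientAddGroup.mk (C.subDivisor P Q)

theorem subClass_mem_jacRational {P Q : C.GeomPoint} (hP : C.IsRationalPoint P)
    (hQ : C.IsRationalPoint Q) : C.subClass P Q ∈ C.jacRational := by
  intro σ
  change QuotientAddGroup.mk ((C.galAut σ).degZeroMap (C.subDivisor P Q)) = _
  congr 1
  refine Subtype.ext ?_
  change (C.galAut σ).divisorMap (Finsupp.single P 1 - Finsupp.single Q 1) = _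
  have h (R : C.GeomPoint) (hR : C.IsRationalPoint R) :
      (C.galAut σ).divisorMap (Finsupp.single R 1) = Finsupp.single R 1 := by
    refine (Finsupp.equivMapDomain_single _ _ _).trans ?_
    congr 1
    exact hR σ
  rw [map_sub, h P hP, h Q hQ]
  rfl

end HyperellipticCurve

end

theorem mainTheorem11 (l : ℚ) (hl : l ≠ 0) (hl1 : l ^ 2 ≠ 1) (m : ℕ) (hm : 1 < m) :
    (∃ P : (yamamotoCurve l hl hl1 m hm).GeomPoint,
      (yamamotoCurve l hl hl1 m hm).IsRationalPoint P ∧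
      (yamamotoCurve l hl hl1 m hm).IsWeierstrassPoint P) ∧
    2 ≤ mRank m (AddCommGroup.torsion (yamamotoCurve l hl hl1 m hm).jacRational) := by
  refine ⟨yamamotoCurve.exists_rational_weierstrassPoint, ?_⟩
  have hm0 : 0 < m := by omega
  obtain ⟨P₁, h₁⟩ := yamamotoCurve.exists_isInfinitePoint (hl := hl) (hl1 := hl1) (hm := hm)
  have h₂ := h₁.involution
  obtain ⟨P₂, hP₂⟩ : ∃ P₂, P₂ = (yamamotoCurve l hl hl1 m hm).involution.pointMap P₁ := ⟨_, rfl⟩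
  rw [← hP₂] at h₂
  obtain ⟨Z, hZ⟩ := yamamotoCurve.exists_isZeroPoint (hl := hl) (hl1 := hl1) (hm := hm) rfl
    (yamamotoCurve.ell_ne_zero hl)
  have r₁ := yamamotoCurve.IsInfinitePoint.isRationalPoint (e := 1) (by norm_num)
    (by rwa [Rat.cast_one])
  have r₂ := yamamotoCurve.IsInfinitePoint.isRationalPoint (e := -1) (by norm_num)
    (P := P₂) (by rwa [Rat.cast_neg, Rat.cast_one])
  have rZ := hZ.isRationalPoint rfl hl
  have t₁ : m • (yamamotoCurve l hl hl1 m hm).subClass P₁ P₂ = 0 := by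
    refine (QuotientAddGroup.eq_zero_iff (m • _)).mpr ?_
    rw [AddSubgroup.mem_addSubgroupOf]
    have := yamamotoCurve.ord_linFun_infinity h₁ h₂
    refine ⟨_, fun h0 => ?_, this⟩
    have h := this P₁
    rw [h0, AddValuation.map_zero] at h
    exact WithTop.top_ne_coe h
  have t₂ : m • (yamamotoCurve l hl hl1 m hm).subClass Z P₂ = 0 := by
    refine (QuotientAddGroup.eq_zero_iff (m • _)).mpr ?_
    rw [AddSubgroup.mem_addSubgroupOf]
    have := yamamotoCurve.ord_linFun_zero h₁ h₂ hZ
    refine ⟨_, fun h0 => ?_, this⟩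
    have h := this P₁
    rw [h0, AddValuation.map_zero] at h
    exact WithTop.top_ne_coe h
  let c : (yamamotoCurve l hl hl1 m hm).jacRational :=
    ⟨_, (yamamotoCurve l hl hl1 m hm).subClass_mem_jacRational r₁ r₂⟩
  let d : (yamamotoCurve l hl hl1 m hm).jacRational :=
    ⟨_, (yamamotoCurve l hl hl1 m hm).subClass_mem_jacRational rZ r₂⟩
  have hc : m • c = 0 := Subtype.ext t₁
  have hd : m • d = 0 := Subtype.ext t₂
  refine two_le_mRank hm0 (c := ⟨c, isOfFinAddOrder_iff_nsmul_eq_zero.mpr ⟨m, hm0, hc⟩⟩)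
    (d := ⟨d, isOfFinAddOrder_iff_nsmul_eq_zero.mpr ⟨m, hm0, hd⟩⟩) (Subtype.ext hc)
    (Subtype.ext hd) fun a b ha hb hab => ?_
  have e : (QuotientAddGroup.mk (a • (yamamotoCurve l hl hl1 m hm).subDivisor P₁ P₂ +
      b • (yamamotoCurve l hl hl1 m hm).subDivisor Z P₂) : (yamamotoCurve l hl hl1 m hm).JacGeom)
      = 0 := congrArg Subtype.val (congrArg Subtype.val hab)
  rw [QuotientAddGroup.eq_zero_iff, AddSubgroup.mem_addSubgroupOf] at e
  exact yamamotoCurve.eq_zero_of_mem_principal h₁ h₂ hZ ha hb e
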